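/- **Theorem (TV local-error framework).** There is a universal constant $C>0$ with the following property. For every integer $N\ge 1$ and every $L\in[\tfrac12,2]$ there are shift coefficients $\eta_n\in[0,1]$, $0\le n\le N-1$, with $\eta_{N-1}=1$, depending only on $N$ and $L$, such that the following holds. Let $d\ge 0$, let $P,\widetilde P$ be Markov kernels on $\mathbb R^d$ (for instance, $P$ the kernel of an SDE run for the time $\lambda$ and $\widetilde P$ one step of a discretization scheme), let $\lambda>0$, $c\ge0$, let $a_0,C_{\mathrm{TV}}:\mathbb R^d\to[0,\infty)$ and $a_1:\mathbb R^d\times\mathbb R^d\to[0,\infty)$ be measurable, and suppose that for all $x,y\in\mathbb R^d$ $$\mathcal W_2^2(\delta_x\widetilde P,\delta_yP)\le L^2\|x-y\|^2+2a_1(x,y)\|x-y\|+a_0(x)^2,$$ $$\mathrm{KL}(\delta_xP\,\|\,\delta_yP)\le c\|x-y\|^2,\qquad TV(\delta_x\widetilde P,\delta_xP)\le C_{\mathrm{TV}}(x)\lambda ,$$ where $TV(\rho,\rho')=\sup_A|\rho(A)-\rho'(A)|$. Let $\mu,\nu$ be probability measures on $\mathbb R^d$ with finite second moments. *Auxiliary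 process.* Put $\nu_0'=\nu$ and, for $0\le n\le N-1$, let $(\widetilde X_n,Y_n')$ be an optimal coupling (for the cost $\|x-y\|^2$) of $\mu\widetilde P^n$ and $\nu_n'$, let $\widetilde Y_n=(1-\eta_n)Y_n'+\eta_n\widetilde X_n$, and, for $n\le N-2$, let $\nu'_{n+1}=\mathrm{Law}(\widetilde Y_n)P$. Such an auxiliary process exists, and for each one $$TV(\mu\widetilde P^N,\nu P^N)\le C\left(\overline C_{\mathrm{TV}}\lambda+\sqrt{c\left[\tfrac{L^{-1}-1}{L^{-N}-1}\mathcal W_2^2(\mu,\nu)+\bigl(((L-1)N)\vee\log\bar N\bigr)\overline a_0^{\,2}+\bar N\,\overline a_1^{\,2}\right]}\right),$$ where $\bar N=N\wedge\frac1{(1-L)_+}$ (with $1/0=\infty$), the coefficient of $\mathcal W_2^2(\mu,\nu)$ is read as $1/N$ when $L=1$, and $$\overline C_{\mathrm{TV}}=\sup_{0\le n<N}\|C_{\mathrm{TV}}\|_{L^2(\mu\widetilde P^n)},\quad \overline a_0=\sup_{0\le n<N}\|a_0\|_{L^2(\mu\widetilde P^n)},\quad \overline a_1=\sup_{0\le n<N}\|a_1(\widetilde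 X_n,\widetilde Y_n)\|_{L^2}.$$ The quantities $\overline C_{\mathrm{TV}},\overline a_0,\overline a_1$ may be $+\infty$; the bound is then read in $[0,\infty]$ with $0\cdot\infty=0$. -/

import Mathlib

open MeasureTheory ProbabilityTheory
open scoped ENNReal

namespace TVLocalError

noncomputable section

/-- The state space `ℝ^d` with its Euclidean norm. -/
abbrev Eucl (d : ℕ) : Type := EuclideanSpace ℝ (Fin d)

variable {d : ℕ}

/-- `γ` is a coupling of `μ` and `ν`: its two marginals are `μ` and `ν`. -/
def IsCoupling (γ : Measure (Eucl d × Eucl d)) (μ ν : Measure (Eucl d)) : Prop :=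
  γ.map Prod.fst = μ ∧ γ.map Prod.snd = ν

/-- The quadratic transport cost `∫ ‖x - y‖² γ(dx, dy)`, with values in `[0, ∞]`. -/
def transportCost (γ : Measure (Eucl d × Eucl d)) : ℝ≥0∞ :=
  ∫⁻ p, ‖p.1 - p.2‖ₑ ^ 2 ∂γ

/-- The 2-Wasserstein distance, with values in `[0, ∞]`. -/
def W2 (μ ν : Measure (Eucl d)) : ℝ≥0∞ :=
  (⨅ (γ : Measure (Eucl d × Eucl d)) (_ : IsCoupling γ μ ν), transportCost γ) ^ (1 / 2 : ℝ)

/-- `γ` is an optimal coupling of `μ` and `ν` for the quadratic cost. -/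
def IsOptimalCoupling (γ : Measure (Eucl d × Eucl d)) (μ ν : Measure (Eucl d)) : Prop :=
  IsCoupling γ μ ν ∧ transportCost γ = W2 μ ν ^ 2

/-- The total variation distance `sup_A |μ(A) - ν(A)|` over measurable sets `A`. -/
def TV (μ ν : Measure (Eucl d)) : ℝ≥0∞ :=
  ⨆ (A : Set (Eucl d)) (_ : MeasurableSet A), ENNReal.ofReal |μ.real A - ν.real A|

/-- The law `μ Pⁿ` of the Markov chain with initial law `μ` and kernel `P` after `n` steps. -/
def lawAfter (μ : Measure (Eucl d)) (P : Kernel (Eucl d) (Eucl d)) (n : ℕ) : Measure (Eucl d) :=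
  μ.bind (P ^ n : Kernel (Eucl d) (Eucl d))

/-- The shifted point `(1 - η) y + η x`. -/
def shiftPoint (η : ℝ) (x y : Eucl d) : Eucl d := (1 - η) • y + η • x

/-- The auxiliary interpolating process with shift coefficients `η`, recorded through the joint
laws `γ n` of the pairs `(X n, Y' n)`, `0 ≤ n < N`. Here `X` is the chain with kernel `Pt` started
from `μ`, and `Y'` starts from `ν` and is updated by `Y' (n + 1) ∼ P (Ytilde n, ·)` for
`n ≤ N - 2`, with `Ytilde n = (1 - η n) Y' n + η n X n`. At every step the pair `(X n, Y' n)` is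
optimally coupled. (The last update of `Y'`, by `Pt` at time `N - 1`, where `η (N - 1) = 1`,
gives back the law `μ Pt ^ N`, and no pair law beyond `N - 1` is needed.) -/
structure IsAuxProcess (Pt P : Kernel (Eucl d) (Eucl d)) (μ ν : Measure (Eucl d)) (N : ℕ)
    (η : ℕ → ℝ) (γ : ℕ → Measure (Eucl d × Eucl d)) : Prop where
  init : IsOptimalCoupling (γ 0) μ ν
  step : ∀ n, n + 1 < N →
    IsOptimalCoupling (γ (n + 1)) (lawAfter μ Pt (n + 1))
      (P ∘ₘ (γ n).map (fun p => shiftPoint (η n) p.1 p.2))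

/-- `sup_{0 ≤ n < N} ‖f‖_{L²(μ Ptⁿ)}`. -/
def supL2Chain (μ : Measure (Eucl d)) (Pt : Kernel (Eucl d) (Eucl d)) (N : ℕ)
    (f : Eucl d → ℝ) : ℝ≥0∞ :=
  ⨆ (n : ℕ) (_ : n < N), eLpNorm f 2 (lawAfter μ Pt n)

/-- `sup_{0 ≤ n < N} ‖a₁(X n, Ytilde n)‖_{L²}` along the auxiliary process, where
`Ytilde n = (1 - η n) Y' n + η n X n` and `γ n` is the law of `(X n, Y' n)`. -/
def supL2Aux (N : ℕ) (η : ℕ → ℝ) (γ : ℕ → Measure (Eucl d × Eucl d))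
    (a₁ : Eucl d → Eucl d → ℝ) : ℝ≥0∞ :=
  ⨆ (n : ℕ) (_ : n < N), eLpNorm (fun p => a₁ p.1 (shiftPoint (η n) p.1 p.2)) 2 (γ n)

/-- `(L⁻¹ - 1) / (L⁻ᴺ - 1)`, extended by continuity by the value `1 / N` at `L = 1`. -/
def w2Coeff (L : ℝ) (N : ℕ) : ℝ :=
  if L = 1 then 1 / (N : ℝ) else (L⁻¹ - 1) / ((L ^ N)⁻¹ - 1)

/-- `N ∧ 1 / (1 - L)₊`, where `1 / 0 = ∞`. -/
def Nbar (L : ℝ) (N : ℕ) : ℝ :=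
  if L < 1 then min (N : ℝ) (1 / (1 - L)) else N

end

end TVLocalError

open TVLocalError

/-! The auxiliary process steers `Y'` towards `X` by shifts `η n`, so that at time `N - 1` the
shifted point is `X` itself. Hence one step of `P` from `μ Pt ^ (N - 1)` is the last law of the
auxiliary process, and it differs from `μ Pt ^ N` by a single one-step total variation error
(`IsAuxProcess.TV_le`). All other errors enter through the entropy of the auxiliary process relative
to the `P`-chain from `ν`: each shift moves a point by `η n * ‖X n - Y' n‖`, so the chain rule gives
entropy at most `c * ∑ η n ^ 2 * d n ^ 2`, with `d n` the root mean square distance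
(`IsAuxProcess.entropyLE`). A Pinsker inequality turns this into total variation.

The distances satisfy `d (n+1) ^ 2 ≤ L ^ 2 * x ^ 2 + 2 * b * x + a ^ 2` with `x = (1 - η n) * d n`,
by convexity of the squared Wasserstein distance (`W2_sq_comp_le`), optimality of the couplings and
Cauchy–Schwarz. With `η n = 1 / V n` and `V n = 1 + L⁻² * V (n+1)`, the shift costs `e n = η n * d
n` obey a linear recursion with ratio `L⁻¹`, perturbed by `a / V` in quadrature and by `b / V`
additively; `V` is also the weight that sums it (`sum_sq_le_of_weighted_recursion`). The remaining
sums of `1 / V` and `W / V` are estimated by geometric series.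

Two technical devices: entropy is handled in its Donsker–Varadhan form, whose chain rule needs no
disintegration, and convexity of the Wasserstein cost is obtained by discretization and weak
compactness, without measurable selection of optimal couplings. -/

namespace TVLocalError

/-! ### Geometric sums and the coefficients of the bound. -/

/-- The geometric sum `1 + q + ⋯ + q ^ (m - 1)`. -/
noncomputable def geomSum (q : ℝ) (m : ℕ) : ℝ := ∑ j ∈ Finset.range m, q ^ j

lemma geomSum_succ (q : ℝ) (m : ℕ) : geomSum q (m + 1) = 1 + q * geomSum q m := by
  simp only [geomSum, Finset.sum_range_succ', Finset.mul_sum, pow_succ']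
  ring

@[simp] lemma geomSum_zero (q : ℝ) : geomSum q 0 = 0 := by simp [geomSum]

@[simp] lemma geomSum_one (q : ℝ) : geomSum q 1 = 1 := by simp [geomSum]

lemma geomSum_nonneg {q : ℝ} (hq : 0 ≤ q) (m : ℕ) : 0 ≤ geomSum q m :=
  Finset.sum_nonneg fun _ _ => pow_nonneg hq _

lemma one_le_geomSum {q : ℝ} (hq : 0 ≤ q) {m : ℕ} (hm : 1 ≤ m) : 1 ≤ geomSum q m := by
  obtain ⟨k, rfl⟩ := Nat.exists_eq_add_of_le' hm
  rw [geomSum_succ]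
  have := mul_nonneg hq (geomSum_nonneg hq k)
  linarith

lemma geomSum_mul_sub (q : ℝ) (m : ℕ) : geomSum q m * (q - 1) = q ^ m - 1 :=
  geom_sum_mul q m

/-- For `q ≠ 1` this is `q ^ (2m) - 1 = (q ^ m - 1) * (q ^ m + 1)` divided by `q - 1`. It trades the
ratio `L⁻²` of the shift coefficients for the ratio `L⁻¹` of `w2Coeff`. -/
lemma one_add_pow_mul_geomSum (q : ℝ) (m : ℕ) :
    (1 + q ^ m) * geomSum q m = (1 + q) * geomSum (q ^ 2) m := by
  induction m with
  | zero => simp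
  | succ m ih =>
    have h1 := geomSum_mul_sub q m
    have e : ∀ r : ℝ, geomSum r (m + 1) = geomSum r m + r ^ m := fun r => by
      simp [geomSum, Finset.sum_range_succ]
    rw [e, e, ← pow_mul, mul_comm 2 m, pow_mul]
    linear_combination ih + q ^ m * h1

lemma nat_le_geomSum {q : ℝ} (hq : 1 ≤ q) (m : ℕ) : (m : ℝ) ≤ geomSum q m := by
  have : ∑ j ∈ Finset.range m, (1 : ℝ) ≤ geomSum q m :=
    Finset.sum_le_sum fun j _ => one_le_pow₀ hq
  simpa using this

lemma nat_mul_pow_le_geomSum {q : ℝ} (hq : 0 ≤ q) (hq1 : q ≤ 1) (m : ℕ) :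
    (m : ℝ) * q ^ m ≤ geomSum q m := by
  have : ∑ j ∈ Finset.range m, q ^ m ≤ geomSum q m :=
    Finset.sum_le_sum fun j hj => pow_le_pow_of_le_one hq hq1 (Finset.mem_range.1 hj).le
  simpa using this

lemma w2Coeff_eq_inv_geomSum (L : ℝ) (N : ℕ) :
    w2Coeff L N = (geomSum L⁻¹ N)⁻¹ := by
  unfold w2Coeff
  split_ifs with h
  · simp [h, geomSum]
  · have h1 : L⁻¹ - 1 ≠ 0 := by
      rw [sub_ne_zero]; simpa using h
    have := geomSum_mul_sub L⁻¹ N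
    rw [← inv_pow, ← this, div_mul_cancel_right₀ h1]

lemma inv_geomSum_sq {q : ℝ} (hq : 0 < q) {m : ℕ} (hm : 1 ≤ m) :
    (geomSum (q ^ 2) m)⁻¹ = (1 + q) / ((1 + q ^ m) * geomSum q m) := by
  have h1 := one_le_geomSum hq.le hm
  have h2 := one_le_geomSum (sq_nonneg q) hm
  have : 0 < q ^ m := by positivity
  rw [one_add_pow_mul_geomSum]
  field_simp

lemma inv_geomSum_sq_le {q : ℝ} (hq : 0 < q) {m : ℕ} (hm : 1 ≤ m) :
    (geomSum (q ^ 2) m)⁻¹ ≤ (1 + q) * (geomSum q m)⁻¹ := by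
  have h1 := one_le_geomSum hq.le hm
  have : 0 < q ^ m := by positivity
  rw [inv_geomSum_sq hq hm, ← div_eq_mul_inv]
  gcongr
  nlinarith

lemma geomSum_div_geomSum_sq {q : ℝ} (hq : 0 < q) {m : ℕ} (hm : 1 ≤ m) :
    geomSum q m / geomSum (q ^ 2) m = (1 + q) / (1 + q ^ m) := by
  have h1 := one_le_geomSum hq.le hm
  have : 0 < q ^ m := by positivity
  rw [div_eq_mul_inv, inv_geomSum_sq hq hm]
  field_simp

lemma sum_inv_le_one_add_log (n : ℕ) :
    ∑ m ∈ Finset.range n, ((m : ℝ) + 1)⁻¹ ≤ 1 + Real.log n := by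
  have := harmonic_le_one_add_log n
  simpa [harmonic] using this

/-- Absorbs additive constants into logarithms, for arguments bounded away from `1`. -/
lemma one_le_mul_log {x : ℝ} (hx : 2 ≤ x) : 1 ≤ 3 / 2 * Real.log x := by
  have := Real.log_two_gt_d9
  have := Real.log_le_log (by norm_num) hx
  linarith

/-- The case `L = q⁻¹ ≥ 1`. Writing `G` for the sum of `m` terms with ratio `q`, one has `1 = (1 -
q) * G + q ^ m` and `q ^ m ≤ G / m`, so `1 / G ≤ (1 - q) + 1 / m`. Summing gives a linear and a
harmonic part. -/
lemma sum_inv_geomSum_sq_le_of_le_one {q : ℝ} (hq : 1 / 2 ≤ q) (hq1 : q ≤ 1) {N : ℕ}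
    (hN : 2 ≤ N) :
    ∑ m ∈ Finset.range (N - 1), (geomSum (q ^ 2) (m + 1))⁻¹ ≤
      20 * max ((q⁻¹ - 1) * N) (Real.log N) := by
  have hq0 : 0 < q := by linarith
  have key : ∀ m ∈ Finset.range (N - 1), (geomSum (q ^ 2) (m + 1))⁻¹ ≤
      2 * ((1 - q) + ((m : ℝ) + 1)⁻¹) := by
    intro m _
    refine (inv_geomSum_sq_le hq0 (by omega)).trans ?_
    have h1 := one_le_geomSum hq0.le (m := m + 1) (by omega)
    have h2 := nat_mul_pow_le_geomSum hq0.le hq1 (m + 1)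
    have h3 := geomSum_mul_sub q (m + 1)
    push_cast at h2
    have h4 : (geomSum q (m + 1))⁻¹ ≤ (1 - q) + ((m : ℝ) + 1)⁻¹ := by
      rw [inv_le_iff_one_le_mul₀ (by linarith)]
      have : q ^ (m + 1) ≤ ((m : ℝ) + 1)⁻¹ * geomSum q (m + 1) := by
        rw [inv_mul_eq_div, le_div_iff₀ (by positivity)]
        linarith
      linarith
    have h5 : 0 < (geomSum q (m + 1))⁻¹ := by positivity
    nlinarith
  have hN1 : (2 : ℝ) ≤ N := by exact_mod_cast hN
  have hlog := one_le_mul_log hN1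
  have hs := sum_inv_le_one_add_log (N - 1)
  have hl : Real.log ((N - 1 : ℕ) : ℝ) ≤ Real.log N :=
    Real.log_le_log (by exact_mod_cast (by omega : 0 < N - 1)) (by exact_mod_cast Nat.sub_le N 1)
  have hc : ((N - 1 : ℕ) : ℝ) ≤ N := by exact_mod_cast Nat.sub_le N 1
  have hqi : 1 - q ≤ q⁻¹ - 1 := by
    have : q * q⁻¹ = 1 := by field_simp
    have : 1 ≤ q⁻¹ := (one_le_inv₀ hq0).2 hq1
    nlinarith
  refine (Finset.sum_le_sum key).trans ?_
  rw [← Finset.mul_sum, Finset.sum_add_distrib]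
  simp only [Finset.sum_const, Finset.card_range, nsmul_eq_mul]
  have h6 : ((N - 1 : ℕ) : ℝ) * (1 - q) ≤ (q⁻¹ - 1) * N := by
    rw [mul_comm]
    exact mul_le_mul hqi hc (by positivity) (by linarith)
  have h7 := le_max_left ((q⁻¹ - 1) * N) (Real.log N)
  have h8 := le_max_right ((q⁻¹ - 1) * N) (Real.log N)
  linarith

lemma sum_Ico_inv_sq_le (K n : ℕ) (hK : 1 ≤ K) :
    ∑ m ∈ Finset.Ico K n, (((m : ℝ) + 1) ^ 2)⁻¹ ≤ (K : ℝ)⁻¹ := by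
  have hK0 : (0 : ℝ) < K := by exact_mod_cast hK
  rcases le_or_gt n K with h | h
  · simp [Finset.Ico_eq_empty_of_le h]
  · have : ∀ n, K ≤ n → ∑ m ∈ Finset.Ico K n, (((m : ℝ) + 1) ^ 2)⁻¹ ≤ (K : ℝ)⁻¹ - (n : ℝ)⁻¹ := by
      intro n hn
      induction n, hn using Nat.le_induction with
      | base => simp
      | succ n hn ih =>
        have hn0 : (0 : ℝ) < n := by exact_mod_cast lt_of_lt_of_le hK hn
        rw [Finset.sum_Ico_succ_top hn]
        have : (((n : ℝ) + 1) ^ 2)⁻¹ ≤ (n : ℝ)⁻¹ - ((n : ℝ) + 1)⁻¹ := by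
          rw [inv_sub_inv (by positivity) (by positivity), inv_eq_one_div]
          rw [div_le_div_iff₀ (by positivity) (by positivity)]
          nlinarith
        push_cast
        linarith
    have h1 := this n h.le
    have : (0 : ℝ) ≤ (n : ℝ)⁻¹ := by positivity
    linarith

/-- The terms are at most a multiple of `1 / (m * (2 + (1 - L) * m))`: harmonic up to the scale `x =
1 / (1 - L)`, and of order `x / m ^ 2` beyond it. Hence the sum is logarithmic in `min N x`, the
tail past `x` contributing only a constant. -/
lemma sum_inv_geomSum_sq_le_of_one_lt {L : ℝ} (hL : 1 / 2 ≤ L) (hL1 : L < 1) {N : ℕ}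
    (hN : 2 ≤ N) :
    ∑ m ∈ Finset.range (N - 1), (geomSum (L⁻¹ ^ 2) (m + 1))⁻¹ ≤
      20 * Real.log (min (N : ℝ) (1 / (1 - L))) := by
  have hL0 : 0 < L := by linarith
  set q := L⁻¹ with hq
  have hq1 : 1 < q := (one_lt_inv₀ hL0).2 hL1
  have hq2 : q ≤ 2 := by
    rw [hq, inv_le_comm₀ hL0 (by norm_num)]; linarith
  have hqL : 1 - L ≤ q - 1 := by
    have : q * L = 1 := by rw [hq]; field_simp
    nlinarith
  have key : ∀ m : ℕ, (geomSum (q ^ 2) (m + 1))⁻¹ ≤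
      3 * (((m : ℝ) + 1) * (2 + (1 - L) * ((m : ℝ) + 1)))⁻¹ := by
    intro m
    rw [inv_geomSum_sq (by linarith) (by omega), div_eq_mul_inv]
    have h1 := nat_le_geomSum hq1.le (m + 1)
    have h3 := geomSum_mul_sub q (m + 1)
    push_cast at h1
    have h4 : (0 : ℝ) < 1 - L := by linarith
    have h5 : 2 + (1 - L) * ((m : ℝ) + 1) ≤ 1 + q ^ (m + 1) := by
      have : (1 - L) * ((m : ℝ) + 1) ≤ (q - 1) * geomSum q (m + 1) :=
        mul_le_mul hqL h1 (by positivity) (by linarith)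
      linarith
    have h6 : ((m : ℝ) + 1) * (2 + (1 - L) * ((m : ℝ) + 1)) ≤
        (1 + q ^ (m + 1)) * geomSum q (m + 1) := by
      rw [mul_comm]
      exact mul_le_mul h5 h1 (by positivity) (by positivity)
    have h7 : ((1 + q ^ (m + 1)) * geomSum q (m + 1))⁻¹ ≤
        (((m : ℝ) + 1) * (2 + (1 - L) * ((m : ℝ) + 1)))⁻¹ :=
      inv_anti₀ (by positivity) h6
    refine mul_le_mul (by linarith) h7 (inv_nonneg.2 (mul_nonneg ?_ ?_)) (by norm_num)
    · positivity
    · exact geomSum_nonneg (by linarith) _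
  have small : ∀ m : ℕ, (geomSum (q ^ 2) (m + 1))⁻¹ ≤ 3 / 2 * ((m : ℝ) + 1)⁻¹ := by
    intro m
    refine (key m).trans ?_
    have : (((m : ℝ) + 1) * (2 + (1 - L) * ((m : ℝ) + 1)))⁻¹ ≤ 2⁻¹ * ((m : ℝ) + 1)⁻¹ := by
      rw [← mul_inv, mul_comm (2 : ℝ)]
      apply inv_anti₀ (by positivity)
      have : 0 ≤ (1 - L) * ((m : ℝ) + 1) := mul_nonneg (by linarith) (by positivity)
      gcongr
      linarith
    linarith
  have harm : ∀ n : ℕ, ∑ m ∈ Finset.range n, (geomSum (q ^ 2) (m + 1))⁻¹ ≤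
      3 / 2 * (1 + Real.log n) := by
    intro n
    refine (Finset.sum_le_sum fun m _ => small m).trans ?_
    rw [← Finset.mul_sum]
    gcongr
    exact sum_inv_le_one_add_log n
  have hN1 : (2 : ℝ) ≤ N := by exact_mod_cast hN
  have hl : Real.log ((N - 1 : ℕ) : ℝ) ≤ Real.log N :=
    Real.log_le_log (by exact_mod_cast (by omega : 0 < N - 1)) (by exact_mod_cast Nat.sub_le N 1)
  set x := 1 / (1 - L) with hx
  have hx2 : 2 ≤ x := by
    rw [hx, le_div_iff₀ (by linarith)]; linarith
  rcases le_or_gt (N : ℝ) x with h | h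
  · rw [min_eq_left h]
    have := harm (N - 1)
    have := one_le_mul_log hN1
    linarith
  · rw [min_eq_right h.le]
    set K := ⌊x⌋₊ with hK
    have hK1 : 1 ≤ K := Nat.le_floor (by push_cast; linarith)
    have hKx : (K : ℝ) ≤ x := Nat.floor_le (by linarith)
    have hxK : x ≤ 2 * K := by
      have h1 := Nat.lt_floor_add_one x
      have : (1 : ℝ) ≤ K := by exact_mod_cast hK1
      rw [← hK] at h1
      linarith
    have hKN : K ≤ N - 1 := by
      have : (K : ℝ) < N := by linarith
      have : K < N := by exact_mod_cast this
      omega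
    have hK0 : (0 : ℝ) < K := by exact_mod_cast hK1
    rw [← Finset.sum_range_add_sum_Ico _ hKN]
    have h1 := harm K
    have h2 : Real.log K ≤ Real.log x := Real.log_le_log hK0 hKx
    have h3 : ∑ m ∈ Finset.Ico K (N - 1), (geomSum (q ^ 2) (m + 1))⁻¹ ≤
        3 * x * (K : ℝ)⁻¹ := by
      refine le_trans (Finset.sum_le_sum (g := fun m : ℕ => 3 * x * (((m : ℝ) + 1) ^ 2)⁻¹) ?_) ?_
      · intro m _
        refine (key m).trans ?_
        rw [mul_assoc]
        gcongr
        have h4 : (0 : ℝ) < 1 - L := by linarith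
        have : x * (((m : ℝ) + 1) ^ 2)⁻¹ = (((m : ℝ) + 1) * ((1 - L) * ((m : ℝ) + 1)))⁻¹ := by
          rw [hx]; field_simp
        rw [this]
        have : 0 < (1 - L) * ((m : ℝ) + 1) := by positivity
        apply inv_anti₀ (by positivity)
        gcongr
        linarith
      · rw [← Finset.mul_sum]
        have := sum_Ico_inv_sq_le K (N - 1) hK1
        gcongr
    have h4 : 3 * x * (K : ℝ)⁻¹ ≤ 6 := by
      rw [← div_eq_mul_inv, div_le_iff₀ hK0]
      linarith
    have := one_le_mul_log hx2
    linarith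

lemma sum_inv_geomSum_sq_le {L : ℝ} (hL : 1 / 2 ≤ L) (hL2 : L ≤ 2) {N : ℕ} (hN : 1 ≤ N) :
    ∑ m ∈ Finset.range (N - 1), (geomSum (L⁻¹ ^ 2) (m + 1))⁻¹ ≤
      20 * max ((L - 1) * N) (Real.log (Nbar L N)) := by
  have hL0 : 0 < L := by linarith
  unfold Nbar
  rcases hN.eq_or_lt with rfl | hN
  · have : (0 : ℝ) ≤ max ((L - 1) * (1 : ℕ))
        (Real.log (if L < 1 then min ((1 : ℕ) : ℝ) (1 / (1 - L)) else (1 : ℕ))) := by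
      apply le_max_of_le_right
      split_ifs with h
      · apply Real.log_nonneg
        refine le_min (by simp) ?_
        rw [le_div_iff₀ (by linarith)]
        linarith
      · simp
    simp only [Nat.sub_self, Finset.range_zero, Finset.sum_empty]
    linarith
  · split_ifs with h
    · have := sum_inv_geomSum_sq_le_of_one_lt hL h hN
      have := le_max_right ((L - 1) * N) (Real.log (min (N : ℝ) (1 / (1 - L))))
      linarith
    · have h1 : (1 : ℝ) / 2 ≤ L⁻¹ := by
        rw [le_inv_comm₀ (by norm_num) hL0]; simpa using hL2
      have h2 : L⁻¹ ≤ 1 := inv_le_one_of_one_le₀ (not_lt.1 h)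
      simpa using sum_inv_geomSum_sq_le_of_le_one h1 h2 hN

/-- Each ratio equals `(1 + L⁻¹) / (1 + L⁻¹ ^ m)`. It is at most `3`, and for `L < 1` also at most
`3 * L ^ m`, which is summable with sum of order `1 / (1 - L)`. -/
lemma sum_geomSum_div_le {L : ℝ} (hL : 1 / 2 ≤ L) (N : ℕ) :
    ∑ m ∈ Finset.range (N - 1), geomSum L⁻¹ (m + 1) / geomSum (L⁻¹ ^ 2) (m + 1) ≤
      3 * Nbar L N := by
  have hL0 : 0 < L := by linarith
  have hi : (0 : ℝ) < L⁻¹ := by positivity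
  have h2 : L⁻¹ ≤ 2 := by
    rw [inv_le_comm₀ hL0 (by norm_num)]; linarith
  have hc : ((N - 1 : ℕ) : ℝ) ≤ N := by exact_mod_cast Nat.sub_le N 1
  have h3 : ∑ m ∈ Finset.range (N - 1), geomSum L⁻¹ (m + 1) / geomSum (L⁻¹ ^ 2) (m + 1) ≤
      3 * N := by
    refine le_trans (Finset.sum_le_sum (g := fun _ => (3 : ℝ)) ?_) ?_
    · intro m _
      rw [geomSum_div_geomSum_sq hi (by omega), div_le_iff₀ (by positivity)]
      have : 0 < L⁻¹ ^ (m + 1) := by positivity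
      linarith
    · simp
      linarith
  unfold Nbar
  split_ifs with h
  · rw [mul_min_of_nonneg _ _ (by norm_num)]
    refine le_min h3 ?_
    refine le_trans (Finset.sum_le_sum (g := fun m => 3 * L ^ m) ?_) ?_
    · intro m _
      rw [geomSum_div_geomSum_sq hi (by omega)]
      have h4 : L ^ (m + 1) ≤ L ^ m := pow_le_pow_of_le_one hL0.le h.le (by omega)
      have h5 : (1 + L⁻¹) / (1 + L⁻¹ ^ (m + 1)) ≤ 3 / (L⁻¹ ^ (m + 1)) := by
        have : 0 < L⁻¹ ^ (m + 1) := by positivity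
        gcongr <;> linarith
      rw [inv_pow, div_inv_eq_mul] at h5
      rw [inv_pow]
      linarith
    · rw [← Finset.mul_sum]
      gcongr
      have := geomSum_mul_sub L (N - 1)
      rw [le_div_iff₀ (by linarith)]
      change geomSum L (N - 1) * (1 - L) ≤ 1
      have : 0 ≤ L ^ (N - 1) := by positivity
      linarith
  · exact h3

/-! ### Shift coefficients and the recursion for the shift costs. -/

/-- The shift coefficients `η n = 1 / (1 + L⁻² + ⋯ + L^(-2 (N - n - 1)))`. -/
noncomputable def shiftCoeff (L : ℝ) (N n : ℕ) : ℝ := (geomSum (L⁻¹ ^ 2) (N - n))⁻¹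

lemma shiftCoeff_nonneg (L : ℝ) (N n : ℕ) : 0 ≤ shiftCoeff L N n :=
  inv_nonneg.2 (geomSum_nonneg (sq_nonneg _) _)

lemma shiftCoeff_le_one (L : ℝ) (N n : ℕ) : shiftCoeff L N n ≤ 1 := by
  unfold shiftCoeff
  rcases Nat.eq_zero_or_pos (N - n) with h | h
  · simp [h]
  · exact inv_le_one_of_one_le₀ (one_le_geomSum (sq_nonneg _) h)

lemma shiftCoeff_pred {N : ℕ} (L : ℝ) (hN : 1 ≤ N) : shiftCoeff L N (N - 1) = 1 := by
  have : N - (N - 1) = 1 := by omega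
  simp [shiftCoeff, this]

/-- A discrete Gronwall-type estimate: a nonnegative sequence with
`e (n + 1) ^ 2 ≤ (q e n + b / V (n + 1)) ^ 2 + (a / V (n + 1)) ^ 2`, where the weights
satisfy `V n = 1 + q² V (n + 1)` and `W n = 1 + q W (n + 1)`. -/
lemma sum_sq_le_of_weighted_recursion {q a b : ℝ} (hq : 0 ≤ q) (hb : 0 ≤ b)
    (e V W : ℕ → ℝ) {M : ℕ} (he : ∀ n, 0 ≤ e n)
    (hV : ∀ n ≤ M, 1 ≤ V n) (hVM : V M = 1) (hWM : W M = 1)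
    (hVs : ∀ n < M, V n = 1 + q ^ 2 * V (n + 1)) (hWs : ∀ n < M, W n = 1 + q * W (n + 1))
    (hrec : ∀ n < M, e (n + 1) ^ 2 ≤ (q * e n + b / V (n + 1)) ^ 2 + (a / V (n + 1)) ^ 2) :
    ∑ k ∈ Finset.range (M + 1), e k ^ 2 ≤
      2 * (V 0 * e 0 ^ 2 + a ^ 2 * ∑ k ∈ Finset.range M, (V (k + 1))⁻¹) +
        4 * b ^ 2 * ∑ k ∈ Finset.range M, W (k + 1) / V (k + 1) := by
  -- The two perturbations are separated: `U` carries the initial value and the quadratic error `a`,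
  -- `B` the additive error `b`, and `e ≤ √U + B`.
  obtain ⟨U, hU0, hUs⟩ : ∃ U : ℕ → ℝ, U 0 = e 0 ^ 2 ∧
      ∀ n, U (n + 1) = q ^ 2 * U n + (a / V (n + 1)) ^ 2 :=
    ⟨fun n => Nat.rec (e 0 ^ 2) (fun n u => q ^ 2 * u + (a / V (n + 1)) ^ 2) n, rfl, fun _ => rfl⟩
  obtain ⟨B, hB0, hBs⟩ : ∃ B : ℕ → ℝ, B 0 = 0 ∧ ∀ n, B (n + 1) = q * B n + b / V (n + 1) :=
    ⟨fun n => Nat.rec 0 (fun n u => q * u + b / V (n + 1)) n, rfl, fun _ => rfl⟩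
  have hUn : ∀ n, 0 ≤ U n := by
    intro n
    induction n with
    | zero => rw [hU0]; positivity
    | succ n ih => rw [hUs]; positivity
  have hBn : ∀ n ≤ M, 0 ≤ B n := by
    intro n hn
    induction n with
    | zero => rw [hB0]
    | succ n ih =>
      have := ih (by omega)
      have := hV _ hn
      rw [hBs]; positivity
  have hle : ∀ n ≤ M, e n ≤ √(U n) + B n := by
    intro n hn
    induction n with
    | zero => simp [hU0, hB0, Real.sqrt_sq (he 0)]
    | succ n ih =>
      have ih := ih (by omega)
      have hv := hV _ hn
      have hb' : 0 ≤ b / V (n + 1) := by positivity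
      have hB1 := hBn n (by omega)
      have hs : q * √(U n) ≤ √(U (n + 1)) := by
        apply Real.le_sqrt_of_sq_le
        rw [mul_pow, Real.sq_sqrt (hUn n), hUs]
        nlinarith [sq_nonneg (a / V (n + 1))]
      have hsq : √(U (n + 1)) ^ 2 = (q * √(U n)) ^ 2 + (a / V (n + 1)) ^ 2 := by
        rw [Real.sq_sqrt (hUn _), mul_pow, Real.sq_sqrt (hUn n), hUs]
      have hB2 : 0 ≤ B (n + 1) := hBn _ hn
      apply le_of_sq_le_sq _ (by positivity)
      refine (hrec n (by omega)).trans ?_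
      -- Since `q * √(U n) ≤ √(U (n + 1))`, replacing one by the other in the cross term with `B (n
      -- + 1)` completes the square.
      have h1 : q * e n + b / V (n + 1) ≤ q * √(U n) + B (n + 1) := by
        rw [hBs]; nlinarith
      have h2 : 0 ≤ q * e n + b / V (n + 1) := by
        have := he n; positivity
      have h3 : (q * e n + b / V (n + 1)) ^ 2 ≤ (q * √(U n) + B (n + 1)) ^ 2 :=
        pow_le_pow_left₀ h2 h1 2
      nlinarith [mul_le_mul_of_nonneg_right hs hB2]
  -- Summation by parts: `V` solves the backward recursion dual to that of `U`, so the partial sums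
  -- plus `V n * U n` grow only by the source terms. `W` plays the same role for `B`.
  have hsumU : ∀ n ≤ M, ∑ k ∈ Finset.range n, U k + V n * U n =
      V 0 * e 0 ^ 2 + a ^ 2 * ∑ k ∈ Finset.range n, (V (k + 1))⁻¹ := by
    intro n hn
    induction n with
    | zero => simp [hU0]
    | succ n ih =>
      have ih := ih (by omega)
      have hv := hV _ hn
      rw [Finset.sum_range_succ, Finset.sum_range_succ, mul_add, ← add_assoc (V 0 * e 0 ^ 2),
        ← ih, hUs, hVs n (by omega)]
      field_simp
      ring
  have hsumB : ∀ n ≤ M, ∑ k ∈ Finset.range n, B k + W n * B n =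
      b * ∑ k ∈ Finset.range n, W (k + 1) / V (k + 1) := by
    intro n hn
    induction n with
    | zero => simp [hB0]
    | succ n ih =>
      have ih := ih (by omega)
      have hv := hV _ hn
      rw [Finset.sum_range_succ, Finset.sum_range_succ, mul_add, ← ih, hBs, hWs n (by omega)]
      field_simp
      ring
  -- Squaring `q * B n = B (n + 1) - b / V (n + 1)` and weighting by `V (n + 1)` bounds the sum of
  -- squares by `2 * b` times the sum of `B`, which `hsumB` evaluates.
  have hsumB2 : ∀ n ≤ M, ∑ k ∈ Finset.range n, B k ^ 2 + V n * B n ^ 2 ≤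
      2 * b * ∑ k ∈ Finset.range n, B (k + 1) := by
    intro n hn
    induction n with
    | zero => simp [hB0]
    | succ n ih =>
      have ih := ih (by omega)
      have hv := hV _ hn
      have hv0 : V (n + 1) ≠ 0 := by positivity
      have h1 : V (n + 1) * B (n + 1) ^ 2 - q ^ 2 * V (n + 1) * B n ^ 2 ≤
          2 * b * B (n + 1) := by
        have h2 : q * B n = B (n + 1) - b / V (n + 1) := by rw [hBs]; ring
        have h3 : V (n + 1) * B (n + 1) ^ 2 - q ^ 2 * V (n + 1) * B n ^ 2 =
            2 * b * B (n + 1) - b ^ 2 / V (n + 1) := by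
          have : q ^ 2 * V (n + 1) * B n ^ 2 = V (n + 1) * (q * B n) ^ 2 := by ring
          rw [this, h2]
          field_simp
          ring
        have : 0 ≤ b ^ 2 / V (n + 1) := by positivity
        linarith
      rw [Finset.sum_range_succ, Finset.sum_range_succ, mul_add]
      rw [hVs n (by omega)] at ih
      linarith
  have e1 := hsumU M le_rfl
  have e2 := hsumB M le_rfl
  have e3 := hsumB2 M le_rfl
  rw [hVM, one_mul, ← Finset.sum_range_succ] at e1 e3
  rw [hWM, one_mul, ← Finset.sum_range_succ, Finset.sum_range_succ', hB0, add_zero] at e2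
  rw [← e1, mul_assoc, mul_comm (b ^ 2), sq b, mul_comm _ (b * b), mul_assoc b b, ← e2]
  calc ∑ k ∈ Finset.range (M + 1), e k ^ 2
      ≤ ∑ k ∈ Finset.range (M + 1), (2 * U k + 2 * B k ^ 2) := by
        refine Finset.sum_le_sum fun k hk => ?_
        have hk' : k ≤ M := Nat.lt_succ_iff.1 (Finset.mem_range.1 hk)
        have h1 := pow_le_pow_left₀ (he k) (hle k hk') 2
        have h2 := Real.sq_sqrt (hUn k)
        nlinarith [sq_nonneg (√(U k) - B k)]
    _ ≤ _ := by
        rw [Finset.sum_add_distrib, ← Finset.mul_sum, ← Finset.mul_sum]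
        linarith

/-- Total shift cost of a sequence of distances obeying the one-step bound, for the shift
coefficients `shiftCoeff L N`. -/
theorem sum_shiftCoeff_sq_mul_le {L a b : ℝ} (hL : 1 / 2 ≤ L) (hL2 : L ≤ 2) {N : ℕ} (hN : 1 ≤ N)
    (hb : 0 ≤ b) (d : ℕ → ℝ) (hd : ∀ n, 0 ≤ d n)
    (hrec : ∀ n, n + 1 < N → d (n + 1) ^ 2 ≤ L ^ 2 * ((1 - shiftCoeff L N n) * d n) ^ 2 +
      2 * b * ((1 - shiftCoeff L N n) * d n) + a ^ 2) :
    ∑ n ∈ Finset.range N, shiftCoeff L N n ^ 2 * d n ^ 2 ≤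
      50 * (w2Coeff L N * d 0 ^ 2 + max ((L - 1) * N) (Real.log (Nbar L N)) * a ^ 2 +
        Nbar L N * b ^ 2) := by
  have hL0 : 0 < L := by linarith
  have hi : (0 : ℝ) < L⁻¹ := by positivity
  have hi2 : L⁻¹ ≤ 2 := by
    rw [inv_le_comm₀ hL0 (by norm_num)]; linarith
  obtain ⟨M, rfl⟩ := Nat.exists_eq_add_of_le' hN
  set V : ℕ → ℝ := fun n => geomSum (L⁻¹ ^ 2) (M + 1 - n) with hVdef
  set W : ℕ → ℝ := fun n => geomSum L⁻¹ (M + 1 - n) with hWdef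
  have hV1 : ∀ n ≤ M, 1 ≤ V n := fun n hn => one_le_geomSum (sq_nonneg _) (by omega)
  have hVs : ∀ n < M, V n = 1 + L⁻¹ ^ 2 * V (n + 1) := by
    intro n hn
    have : M + 1 - n = (M + 1 - (n + 1)) + 1 := by omega
    simp only [hVdef]
    rw [this, geomSum_succ]
  have hWs : ∀ n < M, W n = 1 + L⁻¹ * W (n + 1) := by
    intro n hn
    have : M + 1 - n = (M + 1 - (n + 1)) + 1 := by omega
    simp only [hWdef]
    rw [this, geomSum_succ]
  have hη : ∀ n, shiftCoeff L (M + 1) n = (V n)⁻¹ := fun n => rfl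
  have key := sum_sq_le_of_weighted_recursion (q := L⁻¹) (a := a) (b := L⁻¹ * b) hi.le
    (by positivity) (fun n => shiftCoeff L (M + 1) n * d n) V W (M := M)
    (fun n => mul_nonneg (shiftCoeff_nonneg _ _ _) (hd n)) hV1 (by simp [hVdef]) (by simp [hWdef])
    hVs hWs (by
      intro n hn
      have h1 := hrec n (by omega)
      have hv := hV1 n hn.le
      have hv1 := hV1 (n + 1) (by omega)
      simp only [hη] at h1 ⊢
      -- The identity behind the choice of `η`: it expresses the contracted distance `(1 - η n) * d
      -- n` through the shift cost `d n / V n`.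
      have h2 : 1 - (V n)⁻¹ = L⁻¹ ^ 2 * V (n + 1) * (V n)⁻¹ := by
        have := hVs n hn
        field_simp
        field_simp at this
        linarith
      -- Completing the square costs the extra term `(L⁻¹ * b) ^ 2`.
      have h3 : L ^ 2 * ((1 - (V n)⁻¹) * d n) ^ 2 + 2 * b * ((1 - (V n)⁻¹) * d n) + a ^ 2 ≤
          (L⁻¹ * V (n + 1) * ((V n)⁻¹ * d n) + L⁻¹ * b) ^ 2 + a ^ 2 := by
        rw [h2]
        have : 0 ≤ (L⁻¹ * b) ^ 2 := sq_nonneg _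
        have e : (L⁻¹ * V (n + 1) * ((V n)⁻¹ * d n) + L⁻¹ * b) ^ 2 =
            L ^ 2 * (L⁻¹ ^ 2 * V (n + 1) * (V n)⁻¹ * d n) ^ 2 +
              2 * b * (L⁻¹ ^ 2 * V (n + 1) * (V n)⁻¹ * d n) + (L⁻¹ * b) ^ 2 := by
          field_simp
          ring
        linarith
      have h4 := mul_le_mul_of_nonneg_left (h1.trans h3) (sq_nonneg (V (n + 1))⁻¹)
      calc ((V (n + 1))⁻¹ * d (n + 1)) ^ 2 = (V (n + 1))⁻¹ ^ 2 * d (n + 1) ^ 2 := by ring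
        _ ≤ _ := h4
        _ = _ := by field_simp)
  have r1 : ∑ k ∈ Finset.range M, (V (k + 1))⁻¹ =
      ∑ m ∈ Finset.range M, (geomSum (L⁻¹ ^ 2) (m + 1))⁻¹ := by
    rw [← Finset.sum_range_reflect]
    refine Finset.sum_congr rfl fun k hk => ?_
    have := Finset.mem_range.1 hk
    have : M + 1 - (M - 1 - k + 1) = k + 1 := by omega
    simp only [hVdef, this]
  have r2 : ∑ k ∈ Finset.range M, W (k + 1) / V (k + 1) =
      ∑ m ∈ Finset.range M, geomSum L⁻¹ (m + 1) / geomSum (L⁻¹ ^ 2) (m + 1) := by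
    rw [← Finset.sum_range_reflect]
    refine Finset.sum_congr rfl fun k hk => ?_
    have := Finset.mem_range.1 hk
    have : M + 1 - (M - 1 - k + 1) = k + 1 := by omega
    simp only [hVdef, hWdef, this]
  have s1 := sum_inv_geomSum_sq_le hL hL2 hN
  have s2 := sum_geomSum_div_le hL (M + 1)
  simp only [Nat.add_sub_cancel] at s1 s2
  have s3 : V 0 * ((V 0)⁻¹ * d 0) ^ 2 ≤ 3 * (w2Coeff L (M + 1) * d 0 ^ 2) := by
    have hv := hV1 0 (Nat.zero_le _)
    have e : V 0 * ((V 0)⁻¹ * d 0) ^ 2 = (V 0)⁻¹ * d 0 ^ 2 := by field_simp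
    rw [e, w2Coeff_eq_inv_geomSum, ← mul_assoc]
    have h1 := inv_geomSum_sq_le hi (m := M + 1) (by omega)
    have h2 : 0 ≤ (geomSum L⁻¹ (M + 1))⁻¹ := inv_nonneg.2 (geomSum_nonneg hi.le _)
    apply mul_le_mul_of_nonneg_right _ (sq_nonneg _)
    refine h1.trans ?_
    nlinarith
  rw [r1, r2] at key
  simp only [hη] at key ⊢
  simp only [mul_pow] at key s3
  have t1 := mul_le_mul_of_nonneg_left s1 (sq_nonneg a)
  have t2 := mul_le_mul_of_nonneg_left s2 (sq_nonneg b)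
  -- The three terms get the constants `2 * 3`, `2 * 20` and `4 * 4 * 3`, all below `50`; the middle
  -- `4` is this bound, since `b` entered as `L⁻¹ * b`.
  have hi4 : L⁻¹ ^ 2 ≤ 4 := by nlinarith
  have t3 : 0 ≤ b ^ 2 * ∑ m ∈ Finset.range M, geomSum L⁻¹ (m + 1) / geomSum (L⁻¹ ^ 2) (m + 1) :=
    mul_nonneg (sq_nonneg _) (Finset.sum_nonneg fun m _ =>
      div_nonneg (geomSum_nonneg hi.le _) (geomSum_nonneg (sq_nonneg _) _))
  have t4 := mul_le_mul_of_nonneg_right hi4 t3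
  have t5 : 0 ≤ w2Coeff L (M + 1) * d 0 ^ 2 := by
    rw [w2Coeff_eq_inv_geomSum]
    exact mul_nonneg (inv_nonneg.2 (geomSum_nonneg hi.le _)) (sq_nonneg _)
  have t6 : 0 ≤ a ^ 2 * max ((L - 1) * ((M + 1 : ℕ) : ℝ)) (Real.log (Nbar L (M + 1))) := by
    have : 0 ≤ a ^ 2 * ∑ m ∈ Finset.range M, (geomSum (L⁻¹ ^ 2) (m + 1))⁻¹ :=
      mul_nonneg (sq_nonneg _) (Finset.sum_nonneg fun m _ =>
        inv_nonneg.2 (geomSum_nonneg (sq_nonneg _) _))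
    linarith
  nlinarith

/-! ### Powers and averages of Markov kernels. -/

section Markov

variable {α β : Type*} [MeasurableSpace α] [MeasurableSpace β]

lemma kernel_pow_succ (P : Kernel α α) (n : ℕ) : P ^ (n + 1) = P ∘ₖ (P ^ n) :=
  pow_succ' P n

instance isMarkovKernel_pow (P : Kernel α α) [IsMarkovKernel P] (n : ℕ) :
    IsMarkovKernel (P ^ n) := by
  induction n with
  | zero => exact inferInstanceAs (IsMarkovKernel Kernel.id)
  | succ n ih => rw [kernel_pow_succ]; infer_instance

lemma integral_comp_of_bounded (μ : Measure α) [IsFiniteMeasure μ] (κ : Kernel α β)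
    [IsMarkovKernel κ] {φ : β → ℝ} (hφ : Measurable φ) {C : ℝ} (hC : ∀ x, |φ x| ≤ C) :
    ∫ y, φ y ∂(κ ∘ₘ μ) = ∫ x, ∫ y, φ y ∂(κ x) ∂μ := by
  have hi : Integrable φ (κ ∘ₘ μ) :=
    Integrable.of_bound hφ.aestronglyMeasurable C (.of_forall hC)
  rw [Measure.comp_eq_comp_const_apply] at hi ⊢
  rw [Kernel.integral_comp hi]
  simp

end Markov

/-! ### Entropy in variational form: chain rule and Pinsker inequality. -/

section DonskerVaradhan

variable {α β : Type*} [MeasurableSpace α] [MeasurableSpace β]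

/-- The Donsker–Varadhan form of the entropy bound `KL(μ ‖ ν) ≤ K`. -/
def EntropyLE (μ ν : Measure α) (K : ℝ) : Prop :=
  ∀ φ : α → ℝ, Measurable φ → (∃ C, ∀ x, |φ x| ≤ C) →
    ∫ x, φ x ∂μ ≤ K + Real.log (∫ x, Real.exp (φ x) ∂ν)

lemma integrable_of_measurable_of_bounded (μ : Measure α) [IsFiniteMeasure μ] {φ : α → ℝ}
    (hφ : Measurable φ) (hC : ∃ C, ∀ x, |φ x| ≤ C) : Integrable φ μ :=
  let ⟨C, hC⟩ := hC
  Integrable.of_bound hφ.aestronglyMeasurable C (.of_forall hC)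

omit [MeasurableSpace α] in
lemma exp_bounded {φ : α → ℝ} (hC : ∃ C, ∀ x, |φ x| ≤ C) : ∃ C, ∀ x, |Real.exp (φ x)| ≤ C := by
  obtain ⟨C, hC⟩ := hC
  refine ⟨Real.exp C, fun x => ?_⟩
  rw [Real.abs_exp]
  exact Real.exp_le_exp.2 ((le_abs_self _).trans (hC x))

lemma entropyLE_of_klDiv_le {μ ν : Measure α} [IsProbabilityMeasure μ] [IsProbabilityMeasure ν]
    {K : ℝ} (hK : 0 ≤ K) (h : InformationTheory.klDiv μ ν ≤ ENNReal.ofReal K) :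
    EntropyLE μ ν K := by
  intro φ hφ hC
  have hne : InformationTheory.klDiv μ ν ≠ ∞ := (h.trans_lt ENNReal.ofReal_lt_top).ne
  obtain ⟨hac, hint⟩ := InformationTheory.klDiv_ne_top_iff.1 hne
  have hφμ := integrable_of_measurable_of_bounded μ hφ hC
  have hexp : Integrable (fun x => Real.exp (φ x)) ν :=
    integrable_of_measurable_of_bounded ν hφ.exp (exp_bounded hC)
  have hp : IsProbabilityMeasure (ν.tilted φ) := isProbabilityMeasure_tilted hexp
  -- Nonnegativity of the divergence of `μ` from `ν` tilted by `φ` is exactly the variational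
  -- inequality.
  have h1 := InformationTheory.integral_llr_add_sub_measure_univ_nonneg
    (hac.trans (absolutelyContinuous_tilted hexp)) (integrable_llr_tilted_right hac hφμ hint hexp)
  rw [integral_llr_tilted_right hac hφμ hexp hint,
    ← InformationTheory.toReal_klDiv_of_measure_eq hac (by simp)] at h1
  have h2 := ENNReal.toReal_le_of_le_ofReal hK h
  simp only [measureReal_def, measure_univ, ENNReal.toReal_one] at h1
  linarith

lemma entropyLE_self (μ : Measure α) [IsProbabilityMeasure μ] : EntropyLE μ μ 0 :=
  entropyLE_of_klDiv_le le_rfl (by simp)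

lemma integral_exp_pos_of_bounded (ν : Measure α) [IsProbabilityMeasure ν] {φ : α → ℝ}
    (hφ : Measurable φ) {C : ℝ} (hC : ∀ x, |φ x| ≤ C) :
    Real.exp (-C) ≤ ∫ x, Real.exp (φ x) ∂ν := by
  have h1 : ∫ _, Real.exp (-C) ∂ν ≤ ∫ x, Real.exp (φ x) ∂ν := by
    refine integral_mono (integrable_const _)
      (integrable_of_measurable_of_bounded ν hφ.exp (exp_bounded ⟨C, hC⟩)) fun x => ?_
    exact Real.exp_le_exp.2 (neg_le_of_abs_le (hC x))
  simpa using h1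

/-- One step of the chain rule: if `γ` has a second marginal with entropy at most `K` with
respect to `ν` and `κ p` has entropy at most `g p` with respect to `P p.2`, then
`κ ∘ₘ γ` has entropy at most `K + ∫ g ∂γ` with respect to `P ∘ₘ ν`. -/
lemma EntropyLE.comp {γ : Measure (β × α)} [IsProbabilityMeasure γ] {ν : Measure α}
    [IsProbabilityMeasure ν] {κ : Kernel (β × α) α} {P : Kernel α α} [IsMarkovKernel κ]
    [IsMarkovKernel P] {K : ℝ} {g : β × α → ℝ} (hγ : EntropyLE (γ.map Prod.snd) ν K)
    (hg : Integrable g γ) (hκ : ∀ p, EntropyLE (κ p) (P p.2) (g p)) :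
    EntropyLE (κ ∘ₘ γ) (P ∘ₘ ν) (K + ∫ p, g p ∂γ) := by
  rintro φ hφ ⟨C, hC⟩
  -- `ψ` is the test function for the previous time: its exponential has the same `ν`-integral as
  -- `exp φ` has under `P ∘ₘ ν`, while the entropy bound for `κ p` compares `∫ φ ∂(κ p)` with `g p +
  -- ψ p.2`.
  set ψ : α → ℝ := fun y => Real.log (∫ z, Real.exp (φ z) ∂(P y)) with hψ
  have hIm : Measurable fun y => ∫ z, Real.exp (φ z) ∂(P y) :=
    (hφ.exp.stronglyMeasurable.integral_kernel).measurable
  have hψm : Measurable ψ := hIm.log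
  have hlow : ∀ y, Real.exp (-C) ≤ ∫ z, Real.exp (φ z) ∂(P y) := fun y =>
    integral_exp_pos_of_bounded (P y) hφ hC
  have hupp : ∀ y, ∫ z, Real.exp (φ z) ∂(P y) ≤ Real.exp C := fun y => by
    have h1 : ∫ z, Real.exp (φ z) ∂(P y) ≤ ∫ _, Real.exp C ∂(P y) :=
      integral_mono (integrable_of_measurable_of_bounded _ hφ.exp (exp_bounded ⟨C, hC⟩))
        (integrable_const _) fun x => Real.exp_le_exp.2 (le_of_abs_le (hC x))
    simpa using h1
  have hpos : ∀ y, 0 < ∫ z, Real.exp (φ z) ∂(P y) := fun y => (Real.exp_pos _).trans_le (hlow y)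
  have hψb : ∀ y, |ψ y| ≤ C := fun y => by
    rw [abs_le]
    exact ⟨(Real.le_log_iff_exp_le (hpos y)).2 (hlow y), (Real.log_le_iff_le_exp (hpos y)).2 (hupp y)⟩
  have hexpψ : ∀ y, Real.exp (ψ y) = ∫ z, Real.exp (φ z) ∂(P y) := fun y => Real.exp_log (hpos y)
  have h1 := hγ ψ hψm ⟨C, hψb⟩
  rw [integral_map measurable_snd.aemeasurable hψm.aestronglyMeasurable] at h1
  have h2 : ∫ y, Real.exp (ψ y) ∂ν = ∫ z, Real.exp (φ z) ∂(P ∘ₘ ν) := by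
    obtain ⟨D, hD⟩ := exp_bounded ⟨C, hC⟩
    rw [integral_comp_of_bounded ν P hφ.exp hD]
    simp only [hexpψ]
  rw [h2] at h1
  have h3 : ∫ y, φ y ∂(κ ∘ₘ γ) ≤ ∫ p, (g p + ψ p.2) ∂γ := by
    rw [integral_comp_of_bounded γ κ hφ hC]
    have hψi : Integrable (fun p : β × α => ψ p.2) γ :=
      integrable_of_measurable_of_bounded γ (hψm.comp measurable_snd) ⟨C, fun p => hψb p.2⟩
    refine integral_mono ?_ (hg.add hψi) fun p => hκ p φ hφ ⟨C, hC⟩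
    refine integrable_of_measurable_of_bounded γ
      (hφ.stronglyMeasurable.integral_kernel).measurable ⟨C, fun p => ?_⟩
    have := norm_integral_le_of_norm_le_const (μ := κ p) (f := φ) (C := C) (.of_forall hC)
    simpa using this
  have hψi : Integrable (fun p : β × α => ψ p.2) γ :=
    integrable_of_measurable_of_bounded γ (hψm.comp measurable_snd) ⟨C, fun p => hψb p.2⟩
  rw [integral_add hg hψi] at h3
  linarith

/-- A form of Pinsker's inequality. -/
lemma EntropyLE.measureReal_sub_le {μ ν : Measure α} [IsProbabilityMeasure μ]
    [IsProbabilityMeasure ν] {K : ℝ} (h : EntropyLE μ ν K) {A : Set α} (hA : MeasurableSet A) :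
    μ.real A - ν.real A ≤ 2 * √K := by
  set Δ := μ.real A - ν.real A with hΔ
  rcases le_or_gt Δ 0 with h0 | h0
  · exact h0.trans (by positivity)
  have hμ1 : μ.real A ≤ 1 := measureReal_le_one
  have hν1 : ν.real A ≤ 1 := measureReal_le_one
  have hν0 : 0 ≤ ν.real A := measureReal_nonneg
  -- The test function `t` on `A` yields `Δ * t ≤ K + t ^ 2`; the choice `t = Δ / 2` optimizes this
  -- to `t ^ 2 ≤ K`.
  set t := Δ / 2 with ht
  have ht0 : 0 < t := by positivity
  have ht1 : t ≤ 1 := by rw [ht]; linarith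
  have h1 := h (A.indicator fun _ => t) (measurable_const.indicator hA)
    ⟨t, fun x => by by_cases hx : x ∈ A <;> simp [hx, abs_of_pos ht0, ht0.le]⟩
  rw [integral_indicator_const _ hA] at h1
  have h2 : ∫ x, Real.exp (A.indicator (fun _ => t) x) ∂ν =
      1 + ν.real A * (Real.exp t - 1) := by
    have e : ∀ x, Real.exp (A.indicator (fun _ => t) x) =
        1 + A.indicator (fun _ => Real.exp t - 1) x := fun x => by
      by_cases hx : x ∈ A <;> simp [hx]
    simp_rw [e]
    rw [integral_add (integrable_const _) ((integrable_const _).indicator hA),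
      integral_indicator_const _ hA]
    simp
  rw [h2] at h1
  have h3 : Real.exp t - 1 ≤ t + t ^ 2 := by
    have := Real.abs_exp_sub_one_sub_id_le (x := t) (by rw [abs_of_pos ht0]; exact ht1)
    have := le_of_abs_le this
    linarith
  have h4 : 0 ≤ Real.exp t - 1 := by
    have := Real.add_one_le_exp t
    linarith
  have h5 : Real.log (1 + ν.real A * (Real.exp t - 1)) ≤ ν.real A * (Real.exp t - 1) := by
    have := Real.log_le_sub_one_of_pos (x := 1 + ν.real A * (Real.exp t - 1)) (by positivity)
    linarith
  have h6 : ν.real A * (Real.exp t - 1) ≤ ν.real A * t + t ^ 2 := by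
    have a1 := mul_le_mul_of_nonneg_left h3 hν0
    have a2 := mul_le_mul_of_nonneg_right hν1 (sq_nonneg t)
    linarith
  simp only [smul_eq_mul] at h1
  have h7 : Δ * t ≤ K + t ^ 2 := by
    rw [hΔ, sub_mul]
    linarith
  have h8 : t ^ 2 ≤ K := by
    have : Δ = 2 * t := by rw [ht]; ring
    rw [this] at h7
    linarith
  have h9 := Real.le_sqrt_of_sq_le h8
  linarith

lemma EntropyLE.abs_measureReal_sub_le {μ ν : Measure α} [IsProbabilityMeasure μ]
    [IsProbabilityMeasure ν] {K : ℝ} (h : EntropyLE μ ν K) {A : Set α} (hA : MeasurableSet A) :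
    |μ.real A - ν.real A| ≤ 2 * √K := by
  have h1 := h.measureReal_sub_le hA
  have h2 := h.measureReal_sub_le hA.compl
  rw [probReal_compl_eq_one_sub hA, probReal_compl_eq_one_sub hA] at h2
  rw [abs_le]
  constructor <;> linarith

end DonskerVaradhan

/-! ### Total variation: entropy bound, triangle inequality, mixtures. -/

section TotalVariation

variable {d : ℕ}

lemma TV_le_of_entropyLE {μ ν : Measure (Eucl d)} [IsProbabilityMeasure μ]
    [IsProbabilityMeasure ν] {K : ℝ} (h : EntropyLE μ ν K) :
    TV μ ν ≤ ENNReal.ofReal (2 * √K) :=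
  iSup₂_le fun _ hA => ENNReal.ofReal_le_ofReal (h.abs_measureReal_sub_le hA)

lemma TV_triangle (μ ν ρ : Measure (Eucl d)) : TV μ ρ ≤ TV μ ν + TV ν ρ := by
  refine iSup₂_le fun A hA => ?_
  calc ENNReal.ofReal |μ.real A - ρ.real A|
      ≤ ENNReal.ofReal (|μ.real A - ν.real A| + |ν.real A - ρ.real A|) :=
        ENNReal.ofReal_le_ofReal (abs_sub_le _ _ _)
    _ = ENNReal.ofReal |μ.real A - ν.real A| + ENNReal.ofReal |ν.real A - ρ.real A| :=
        ENNReal.ofReal_add (abs_nonneg _) (abs_nonneg _)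
    _ ≤ _ := add_le_add (le_iSup₂ (f := fun A _ => ENNReal.ofReal |μ.real A - ν.real A|) A hA)
        (le_iSup₂ (f := fun A _ => ENNReal.ofReal |ν.real A - ρ.real A|) A hA)

lemma measureReal_comp {α β : Type*} [MeasurableSpace α] [MeasurableSpace β] (μ : Measure α)
    [IsFiniteMeasure μ] (κ : Kernel α β) [IsMarkovKernel κ] {A : Set β} (hA : MeasurableSet A) :
    (κ ∘ₘ μ).real A = ∫ x, (κ x).real A ∂μ := by
  have := integral_comp_of_bounded μ κ (φ := A.indicator fun _ => 1)
    (measurable_const.indicator hA) (C := 1) fun x => by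
      by_cases hx : x ∈ A <;> simp [hx]
  simpa [integral_indicator_const _ hA] using this

/-- Measurability of `x ↦ TV (κ x) (η x)` is not needed, because the lower integral is monotone for
arbitrary functions. -/
lemma TV_comp_le (μ : Measure (Eucl d)) [IsProbabilityMeasure μ]
    (κ η : Kernel (Eucl d) (Eucl d)) [IsMarkovKernel κ] [IsMarkovKernel η] :
    TV (κ ∘ₘ μ) (η ∘ₘ μ) ≤ ∫⁻ x, TV (κ x) (η x) ∂μ := by
  refine iSup₂_le fun A hA => ?_
  have hm : ∀ ξ : Kernel (Eucl d) (Eucl d), Measurable fun x => (ξ x).real A := fun ξ =>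
    (ξ.measurable_coe hA).ennreal_toReal
  have hi : ∀ ξ : Kernel (Eucl d) (Eucl d), IsMarkovKernel ξ →
      Integrable (fun x => (ξ x).real A) μ := fun ξ _ =>
    integrable_of_measurable_of_bounded μ (hm ξ)
      ⟨1, fun x => by rw [abs_of_nonneg measureReal_nonneg]; exact measureReal_le_one⟩
  rw [measureReal_comp μ κ hA, measureReal_comp μ η hA,
    ← integral_sub (hi κ inferInstance) (hi η inferInstance), ← Real.norm_eq_abs,
    ofReal_norm]
  refine (enorm_integral_le_lintegral_enorm _).trans (lintegral_mono fun x => ?_)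
  rw [← ofReal_norm, Real.norm_eq_abs]
  exact le_iSup₂ (f := fun A _ => ENNReal.ofReal |(κ x).real A - (η x).real A|) A hA

end TotalVariation

open Filter Topology

/-! ### Compactness of couplings and existence of optimal ones. -/

section Coupling

variable {d : ℕ}

lemma W2_sq (μ ν : Measure (Eucl d)) :
    W2 μ ν ^ 2 = ⨅ (γ : Measure (Eucl d × Eucl d)) (_ : IsCoupling γ μ ν), transportCost γ := by
  rw [W2, ← ENNReal.rpow_natCast, ← ENNReal.rpow_mul]
  norm_num

lemma IsCoupling.W2_sq_le {γ : Measure (Eucl d × Eucl d)} {μ ν : Measure (Eucl d)}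
    (h : IsCoupling γ μ ν) : W2 μ ν ^ 2 ≤ transportCost γ := by
  rw [W2_sq]
  exact iInf₂_le γ h

lemma IsCoupling.isProbabilityMeasure {γ : Measure (Eucl d × Eucl d)} {μ ν : Measure (Eucl d)}
    [IsProbabilityMeasure μ] (h : IsCoupling γ μ ν) : IsProbabilityMeasure γ := by
  have h1 := h.1
  constructor
  have h2 : γ.map Prod.fst Set.univ = 1 := by rw [h1]; exact measure_univ
  rwa [Measure.map_apply measurable_fst .univ, Set.preimage_univ] at h2

lemma isCoupling_prod (μ ν : Measure (Eucl d)) [IsProbabilityMeasure μ] [IsProbabilityMeasure ν] :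
    IsCoupling (μ.prod ν) μ ν := by
  constructor <;> simp

/-- A convergent sequence together with its limit is compact, hence tight by the converse half of
Prokhorov's theorem. -/
lemma isTightMeasureSet_range_of_tendsto {p : ℕ → ProbabilityMeasure (Eucl d)}
    {p₀ : ProbabilityMeasure (Eucl d)} (hp : Tendsto p atTop (𝓝 p₀)) :
    IsTightMeasureSet (Set.range fun n => (p n : Measure (Eucl d))) := by
  have h1 : IsCompact (insert p₀ (Set.range p)) := hp.isCompact_insert_range
  have h2 : IsCompact (closure (insert p₀ (Set.range p))) := by
    rwa [h1.isClosed.closure_eq]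
  refine (isTightMeasureSet_of_isCompact_closure h2).subset ?_
  rintro _ ⟨n, rfl⟩
  exact ⟨p n, Set.mem_insert_of_mem _ ⟨n, rfl⟩, rfl⟩

lemma transportCost_eq_lintegral_ofReal (γ : Measure (Eucl d × Eucl d)) :
    transportCost γ = ∫⁻ p, ENNReal.ofReal (‖p.1 - p.2‖ ^ 2) ∂γ := by
  unfold transportCost
  refine lintegral_congr fun p => ?_
  rw [ENNReal.ofReal_pow (norm_nonneg _), ofReal_norm]

/-- Couplings of weakly convergent sequences have a limit point, which couples the limits, and the
transport cost is lower semicontinuous along it. -/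
theorem exists_coupling_of_tendsto {p q : ℕ → ProbabilityMeasure (Eucl d)}
    {p₀ q₀ : ProbabilityMeasure (Eucl d)} (hp : Tendsto p atTop (𝓝 p₀))
    (hq : Tendsto q atTop (𝓝 q₀)) {π : ℕ → Measure (Eucl d × Eucl d)}
    (hπ : ∀ n, IsCoupling (π n) (p n) (q n)) {c : ℝ≥0∞} {ε : ℕ → ℝ≥0∞}
    (hε : Tendsto ε atTop (𝓝 0)) (hc : ∀ n, transportCost (π n) ≤ c + ε n) :
    ∃ γ, IsCoupling γ (p₀ : Measure (Eucl d)) (q₀ : Measure (Eucl d)) ∧ transportCost γ ≤ c := by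
  have hprob : ∀ n, IsProbabilityMeasure (π n) := fun n => (hπ n).isProbabilityMeasure
  let Q : ℕ → ProbabilityMeasure (Eucl d × Eucl d) := fun n => ⟨π n, hprob n⟩
  have htight : IsTightMeasureSet
      {((m : ProbabilityMeasure (Eucl d × Eucl d)) : Measure (Eucl d × Eucl d)) |
        m ∈ Set.range Q} := by
    refine IsTightMeasureSet.prodMk ?_ ?_
    · refine (isTightMeasureSet_range_of_tendsto hp).subset ?_
      rintro _ ⟨_, ⟨_, ⟨n, rfl⟩, rfl⟩, rfl⟩
      exact ⟨n, (hπ n).1.symm⟩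
    · refine (isTightMeasureSet_range_of_tendsto hq).subset ?_
      rintro _ ⟨_, ⟨_, ⟨n, rfl⟩, rfl⟩, rfl⟩
      exact ⟨n, (hπ n).2.symm⟩
  have hcomp := isCompact_closure_of_isTightMeasureSet htight
  obtain ⟨m, -, φ, hφ, hm⟩ :=
    hcomp.tendsto_subseq (x := Q) fun n => subset_closure (Set.mem_range_self n)
  have hfst : m.map (f := Prod.fst) measurable_fst.aemeasurable = p₀ := by
    have h1 := ProbabilityMeasure.tendsto_map_of_tendsto_of_continuous _ _ hm continuous_fst
    refine tendsto_nhds_unique h1 ((hp.comp hφ.tendsto_atTop).congr fun n => ?_)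
    apply Subtype.ext
    exact (hπ (φ n)).1.symm
  have hsnd : m.map (f := Prod.snd) measurable_snd.aemeasurable = q₀ := by
    have h1 := ProbabilityMeasure.tendsto_map_of_tendsto_of_continuous _ _ hm continuous_snd
    refine tendsto_nhds_unique h1 ((hq.comp hφ.tendsto_atTop).congr fun n => ?_)
    apply Subtype.ext
    exact (hπ (φ n)).2.symm
  refine ⟨m, ⟨congrArg Subtype.val hfst, congrArg Subtype.val hsnd⟩, ?_⟩
  -- The cost is unbounded, so weak convergence gives only lower semicontinuity, through the
  -- portmanteau bound on open sets.
  have hlsc := lintegral_le_liminf_lintegral_of_forall_isOpen_measure_le_liminf_measure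
    (μ := (m : Measure (Eucl d × Eucl d)))
    (μs := fun n => ((Q ∘ φ) n : Measure (Eucl d × Eucl d)))
    (f := fun p : Eucl d × Eucl d => ‖p.1 - p.2‖ ^ 2) (by fun_prop)
    (fun p => by positivity)
    fun G hG => ProbabilityMeasure.le_liminf_measure_open_of_tendsto hm hG
  rw [← transportCost_eq_lintegral_ofReal] at hlsc
  refine hlsc.trans ?_
  have hlim : Tendsto (fun n => c + ε (φ n)) atTop (𝓝 (c + 0)) :=
    tendsto_const_nhds.add (hε.comp hφ.tendsto_atTop)
  rw [add_zero] at hlim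
  rw [← hlim.liminf_eq]
  refine liminf_le_liminf (.of_forall fun n => ?_)
  change ∫⁻ p, ENNReal.ofReal (‖p.1 - p.2‖ ^ 2) ∂(π (φ n)) ≤ _
  rw [← transportCost_eq_lintegral_ofReal]
  exact hc (φ n)

theorem exists_isOptimalCoupling (μ ν : Measure (Eucl d)) [IsProbabilityMeasure μ]
    [IsProbabilityMeasure ν] : ∃ γ, IsOptimalCoupling γ μ ν := by
  suffices ∃ γ, IsCoupling γ μ ν ∧ transportCost γ ≤ W2 μ ν ^ 2 by
    obtain ⟨γ, h1, h2⟩ := this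
    exact ⟨γ, h1, h2.antisymm h1.W2_sq_le⟩
  rcases eq_or_ne (W2 μ ν ^ 2) ∞ with h | h
  · exact ⟨_, isCoupling_prod μ ν, by rw [h]; exact le_top⟩
  have hex : ∀ n : ℕ, ∃ γ, IsCoupling γ μ ν ∧
      transportCost γ ≤ W2 μ ν ^ 2 + ((n : ℝ≥0∞) + 1)⁻¹ := by
    intro n
    have hlt : W2 μ ν ^ 2 < W2 μ ν ^ 2 + ((n : ℝ≥0∞) + 1)⁻¹ :=
      ENNReal.lt_add_right h (by simp)
    rw [W2_sq] at hlt
    simp only [iInf_lt_iff] at hlt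
    obtain ⟨γ, h1, h2⟩ := hlt
    exact ⟨γ, h1, by rw [W2_sq]; exact h2.le⟩
  choose π h1 h2 using hex
  let p : ProbabilityMeasure (Eucl d) := ⟨μ, inferInstance⟩
  let q : ProbabilityMeasure (Eucl d) := ⟨ν, inferInstance⟩
  have hε : Tendsto (fun n : ℕ => ((n : ℝ≥0∞) + 1)⁻¹) atTop (𝓝 0) := by
    have := (tendsto_add_atTop_iff_nat 1).2 ENNReal.tendsto_inv_nat_nhds_zero
    simpa using this
  exact exists_coupling_of_tendsto (p := fun _ => p) (q := fun _ => q) (p₀ := p) (q₀ := q)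
    tendsto_const_nhds tendsto_const_nhds h1 hε h2

end Coupling

/-! ### Countable approximation of measurable families. -/

section Discretization

/-- Finite intersections of a countable basis. Stability under intersection makes convergence on
these sets imply weak convergence; countability lets a kernel be encoded by a measurable map into `ℕ
→ ℝ`. -/
lemma exists_countable_isPiSystem_basis (α : Type*) [TopologicalSpace α]
    [SecondCountableTopology α] :
    ∃ u : ℕ → Set α, IsPiSystem (Set.range u) ∧ (∀ i, IsOpen (u i)) ∧
      ∀ v : Set α, IsOpen v → ∀ x ∈ v, ∃ s ∈ Set.range u, s ∈ 𝓝 x ∧ s ⊆ v := by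
  let T : Set (Set (Set α)) := {t | t.Finite ∧ t ⊆ TopologicalSpace.countableBasis α}
  have hT : T.Countable :=
    Set.countable_ofPred_finite_subset (TopologicalSpace.countable_countableBasis α)
  have hne : (Set.sInter '' T).Nonempty := ⟨_, ∅, ⟨Set.finite_empty, Set.empty_subset _⟩, rfl⟩
  obtain ⟨u, hu⟩ := (hT.image Set.sInter).exists_eq_range hne
  have hopen : ∀ t ∈ T, IsOpen (⋂₀ t) := fun t ht =>
    ht.1.isOpen_sInter fun s hs => TopologicalSpace.isOpen_of_mem_countableBasis (ht.2 hs)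
  refine ⟨u, ?_, ?_, ?_⟩
  · rw [← hu]
    rintro _ ⟨s, hs, rfl⟩ _ ⟨t, ht, rfl⟩ -
    exact ⟨s ∪ t, ⟨hs.1.union ht.1, Set.union_subset hs.2 ht.2⟩, Set.sInter_union s t⟩
  · intro i
    have : u i ∈ Set.sInter '' T := hu ▸ Set.mem_range_self i
    obtain ⟨t, ht, h⟩ := this
    exact h ▸ hopen t ht
  · intro v hv x hx
    obtain ⟨b, hb, hxb, hbv⟩ :=
      (TopologicalSpace.isBasis_countableBasis α).exists_subset_of_mem_open hx hv
    refine ⟨b, ?_, ?_, hbv⟩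
    · rw [← hu]
      exact ⟨{b}, ⟨Set.finite_singleton b, Set.singleton_subset_iff.2 hb⟩, Set.sInter_singleton b⟩
    · exact (TopologicalSpace.isOpen_of_mem_countableBasis hb).mem_nhds hxb

/-- The `s k` are preimages of a dense sequence in the range of `F`, and `i z` is the first index
that is close enough. Approximating by points of `Z` itself lets any other function on `Z` be
evaluated there, measurable or not. -/
lemma exists_countable_discretization {Z Y : Type*} [MeasurableSpace Z] [Nonempty Z]
    [PseudoMetricSpace Y] [SecondCountableTopology Y] [MeasurableSpace Y] [OpensMeasurableSpace Y]
    {F : Z → Y} (hF : Measurable F) {ε : ℝ} (hε : 0 < ε) :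
    ∃ (s : ℕ → Z) (i : Z → ℕ), Measurable i ∧ ∀ z, dist (F (s (i z))) (F z) < ε := by
  classical
  have : Nonempty (Set.range F) := Set.Nonempty.to_subtype (Set.range_nonempty F)
  have hex : ∀ k : ℕ, ∃ z, F z = TopologicalSpace.denseSeq (Set.range F) k := fun k =>
    (TopologicalSpace.denseSeq (Set.range F) k).2
  choose s hs using hex
  have hfind : ∀ z, ∃ k, dist (F (s k)) (F z) < ε := by
    intro z
    obtain ⟨k, hk⟩ := (TopologicalSpace.denseRange_denseSeq (Set.range F)).exists_dist_lt
      ⟨F z, Set.mem_range_self z⟩ hε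
    refine ⟨k, ?_⟩
    rw [hs, dist_comm]
    exact hk
  refine ⟨s, fun z => Nat.find (hfind z), measurable_find hfind fun k => ?_,
    fun z => Nat.find_spec (hfind z)⟩
  exact measurableSet_lt (measurable_const.dist hF) measurable_const

lemma exists_discretization_seq {Z Y : Type*} [MeasurableSpace Z] [Nonempty Z]
    [TopologicalSpace Y] [TopologicalSpace.PseudoMetrizableSpace Y] [SecondCountableTopology Y]
    [MeasurableSpace Y] [BorelSpace Y] {F : Z → Y} (hF : Measurable F) {f : Z → ℝ}
    (hf : Measurable f) :
    ∃ (s : ℕ → ℕ → Z) (i : ℕ → Z → ℕ), (∀ n, Measurable (i n)) ∧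
      (∀ z, Tendsto (fun n => F (s n (i n z))) atTop (𝓝 (F z))) ∧
      ∀ n z, f (s n (i n z)) ≤ f z + 1 / ((n : ℝ) + 1) := by
  let := TopologicalSpace.pseudoMetrizableSpacePseudoMetric Y
  have h := fun n : ℕ => exists_countable_discretization (hF.prodMk hf)
    (ε := 1 / ((n : ℝ) + 1)) (by positivity)
  choose s i hi hd using h
  refine ⟨s, i, hi, fun z => ?_, fun n z => ?_⟩
  · rw [tendsto_iff_dist_tendsto_zero]
    refine squeeze_zero (fun _ => dist_nonneg) (fun n => ?_) tendsto_one_div_add_atTop_nhds_zero_nat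
    exact (le_max_left _ _).trans (hd n z).le
  · have h1 := (le_max_right _ _).trans (hd n z).le
    rw [Real.dist_eq] at h1
    have h2 := le_of_abs_le h1
    simp only at h2
    linarith

end Discretization

/-! ### Convexity of the squared Wasserstein distance. -/

section Mixture

variable {d : ℕ} {Z : Type*} [MeasurableSpace Z]

/-- The law `κ ∘ₘ ρ` as a bundled probability measure. -/
noncomputable def mixture (κ : Kernel Z (Eucl d)) [IsMarkovKernel κ] (ρ : Measure Z)
    [IsProbabilityMeasure ρ] : ProbabilityMeasure (Eucl d) :=
  ⟨κ ∘ₘ ρ, inferInstance⟩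

lemma tendsto_mixture {ρ : Measure Z} [IsProbabilityMeasure ρ] {κ : Kernel Z (Eucl d)}
    [IsMarkovKernel κ] {u : ℕ → Set (Eucl d)} (hu : IsPiSystem (Set.range u))
    (huo : ∀ k, IsOpen (u k))
    (hub : ∀ v : Set (Eucl d), IsOpen v → ∀ x ∈ v, ∃ s ∈ Set.range u, s ∈ 𝓝 x ∧ s ⊆ v)
    {τ : ℕ → Kernel Z (Eucl d)} [∀ n, IsMarkovKernel (τ n)]
    (h : ∀ k z, Tendsto (fun n => (τ n z).real (u k)) atTop (𝓝 ((κ z).real (u k)))) :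
    Tendsto (fun n => mixture (τ n) ρ) atTop (𝓝 (mixture κ ρ)) := by
  refine hu.tendsto_probabilityMeasure_of_tendsto_of_mem ?_ hub ?_
  · rintro _ ⟨k, rfl⟩
    exact (huo k).measurableSet
  · rintro _ ⟨k, rfl⟩
    have hm := (huo k).measurableSet
    rw [← NNReal.tendsto_coe]
    have e : ∀ m : ProbabilityMeasure (Eucl d), ((m (u k) : NNReal) : ℝ) =
        (m : Measure (Eucl d)).real (u k) := fun m => rfl
    have e' : ∀ (ξ : Kernel Z (Eucl d)) [IsMarkovKernel ξ],
        ((mixture ξ ρ (u k) : NNReal) : ℝ) = ∫ z, (ξ z).real (u k) ∂ρ := fun ξ _ => by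
      rw [e, ← measureReal_comp _ _ hm]
      rfl
    simp only [e']
    refine tendsto_integral_of_dominated_convergence (fun _ => 1) (fun n => ?_)
      (integrable_const _) (fun n => .of_forall fun z => ?_) (.of_forall fun z => h k z)
    · exact ((τ n).measurable_coe hm).ennreal_toReal.aestronglyMeasurable
    · rw [Real.norm_of_nonneg measureReal_nonneg]
      exact measureReal_le_one

/-- Convexity of the squared Wasserstein distance along mixtures. -/
theorem W2_sq_comp_le (ρ : Measure Z) [IsProbabilityMeasure ρ] (κ₁ κ₂ : Kernel Z (Eucl d))
    [IsMarkovKernel κ₁] [IsMarkovKernel κ₂] {f : Z → ℝ} (hf : Measurable f)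
    (h : ∀ z, W2 (κ₁ z) (κ₂ z) ^ 2 ≤ ENNReal.ofReal (f z)) :
    W2 (κ₁ ∘ₘ ρ) (κ₂ ∘ₘ ρ) ^ 2 ≤ ∫⁻ z, ENNReal.ofReal (f z) ∂ρ := by
  have hZ : Nonempty Z := nonempty_of_isProbabilityMeasure ρ
  obtain ⟨u, hu, huo, hub⟩ := exists_countable_isPiSystem_basis (Eucl d)
  have hm : ∀ (κ : Kernel Z (Eucl d)), Measurable fun z (k : ℕ) => (κ z).real (u k) := fun κ =>
    measurable_pi_lambda _ fun k => (κ.measurable_coe (huo k).measurableSet).ennreal_toReal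
  obtain ⟨s, i, hi, hs, hfs⟩ := exists_discretization_seq ((hm κ₁).prodMk (hm κ₂)) hf
  -- This choice need not be measurable in `z`. It is used only at the points `s n (i n z)`, where
  -- it factors through `ℕ`, so `K n` is a kernel.
  choose π hπ using fun z => exists_isOptimalCoupling (κ₁ z) (κ₂ z)
  let K : ℕ → Kernel Z (Eucl d × Eucl d) := fun n =>
    ⟨fun z => π (s n (i n z)),
      (measurable_from_top (f := fun j => π (s n j))).comp (hi n)⟩
  let τ : Kernel Z (Eucl d) → ℕ → Kernel Z (Eucl d) := fun κ n =>
    ⟨fun z => κ (s n (i n z)), (measurable_from_top (f := fun j => κ (s n j))).comp (hi n)⟩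
  have hτ : ∀ (κ : Kernel Z (Eucl d)) [IsMarkovKernel κ] (n : ℕ), IsMarkovKernel (τ κ n) :=
    fun κ _ n => ⟨fun z => inferInstanceAs (IsProbabilityMeasure (κ (s n (i n z))))⟩
  have := hτ κ₁
  have := hτ κ₂
  have hfst : ∀ n, (K n).map Prod.fst = τ κ₁ n := fun n => by
    ext1 z
    rw [Kernel.map_apply _ measurable_fst]
    exact (hπ (s n (i n z))).1.1
  have hsnd : ∀ n, (K n).map Prod.snd = τ κ₂ n := fun n => by
    ext1 z
    rw [Kernel.map_apply _ measurable_snd]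
    exact (hπ (s n (i n z))).1.2
  have hε : Tendsto (fun n : ℕ => ENNReal.ofReal (1 / ((n : ℝ) + 1))) atTop (𝓝 0) := by
    have := ENNReal.tendsto_ofReal (tendsto_one_div_add_atTop_nhds_zero_nat (𝕜 := ℝ))
    simpa using this
  obtain ⟨γ, hγ, hc⟩ := exists_coupling_of_tendsto
    (tendsto_mixture (ρ := ρ) (κ := κ₁) hu huo hub (τ := τ κ₁) fun k z =>
      (tendsto_pi_nhds.1 (hs z).fst_nhds k))
    (tendsto_mixture (ρ := ρ) (κ := κ₂) hu huo hub (τ := τ κ₂) fun k z =>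
      (tendsto_pi_nhds.1 (hs z).snd_nhds k))
    (π := fun n => K n ∘ₘ ρ) (c := ∫⁻ z, ENNReal.ofReal (f z) ∂ρ)
    (fun n => ⟨by
      rw [Measure.map_comp _ _ measurable_fst, hfst]; rfl, by
      rw [Measure.map_comp _ _ measurable_snd, hsnd]; rfl⟩) hε (fun n => by
      unfold transportCost
      rw [Measure.lintegral_bind (K n).aemeasurable (by fun_prop)]
      calc ∫⁻ z, ∫⁻ p, ‖p.1 - p.2‖ₑ ^ 2 ∂(K n z) ∂ρ
          ≤ ∫⁻ z, (ENNReal.ofReal (f z) + ENNReal.ofReal (1 / ((n : ℝ) + 1))) ∂ρ := by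
            refine lintegral_mono fun z => ?_
            refine ((hπ (s n (i n z))).2.le.trans (h _)).trans ?_
            exact (ENNReal.ofReal_le_ofReal (hfs n z)).trans ENNReal.ofReal_add_le
        _ = _ := by
            rw [lintegral_add_left hf.ennreal_ofReal]
            simp)
  exact hγ.W2_sq_le.trans hc

end Mixture

/-! ### The auxiliary process: existence, distances and entropy. -/

section AuxProcess

variable {d : ℕ}

lemma comap_comp_eq_comp_map {α β γ : Type*} [MeasurableSpace α] [MeasurableSpace β]
    [MeasurableSpace γ] (μ : Measure α) {g : α → β} (hg : Measurable g) (κ : Kernel β γ) :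
    (κ.comap g hg) ∘ₘ μ = κ ∘ₘ (μ.map g) := by
  ext s hs
  rw [Measure.bind_apply hs (Kernel.aemeasurable _), Measure.bind_apply hs (Kernel.aemeasurable _),
    lintegral_map (κ.measurable_coe hs) hg]
  rfl

lemma measurable_shiftPoint (η : ℝ) :
    Measurable fun p : Eucl d × Eucl d => shiftPoint η p.1 p.2 := by
  unfold shiftPoint
  fun_prop

lemma shiftPoint_one (x y : Eucl d) : shiftPoint 1 x y = x := by simp [shiftPoint]

lemma norm_sub_shiftPoint {η : ℝ} (hη : η ≤ 1) (x y : Eucl d) :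
    ‖x - shiftPoint η x y‖ = (1 - η) * ‖x - y‖ := by
  have : x - shiftPoint η x y = (1 - η) • (x - y) := by
    simp only [shiftPoint]
    module
  rw [this, norm_smul, Real.norm_of_nonneg (by linarith)]

lemma norm_shiftPoint_sub {η : ℝ} (hη : 0 ≤ η) (x y : Eucl d) :
    ‖shiftPoint η x y - y‖ = η * ‖x - y‖ := by
  have : shiftPoint η x y - y = η • (x - y) := by
    simp only [shiftPoint]
    module
  rw [this, norm_smul, Real.norm_of_nonneg hη]

lemma lawAfter_zero (μ : Measure (Eucl d)) (P : Kernel (Eucl d) (Eucl d)) :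
    lawAfter μ P 0 = μ := by
  change μ.bind (Kernel.id : Kernel (Eucl d) (Eucl d)) = μ
  simp

lemma lawAfter_succ (μ : Measure (Eucl d)) (P : Kernel (Eucl d) (Eucl d)) (n : ℕ) :
    lawAfter μ P (n + 1) = P ∘ₘ lawAfter μ P n := by
  unfold lawAfter
  rw [Measure.comp_assoc, kernel_pow_succ]

instance isProbabilityMeasure_lawAfter (μ : Measure (Eucl d)) [IsProbabilityMeasure μ]
    (P : Kernel (Eucl d) (Eucl d)) [IsMarkovKernel P] (n : ℕ) :
    IsProbabilityMeasure (lawAfter μ P n) := by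
  unfold lawAfter
  infer_instance

instance isProbabilityMeasure_map_shiftPoint (γ : Measure (Eucl d × Eucl d))
    [IsProbabilityMeasure γ] (η : ℝ) :
    IsProbabilityMeasure (γ.map fun p => shiftPoint η p.1 p.2) :=
  Measure.isProbabilityMeasure_map (measurable_shiftPoint η).aemeasurable

variable {P Pt : Kernel (Eucl d) (Eucl d)} [IsMarkovKernel P] [IsMarkovKernel Pt]
  {μ ν : Measure (Eucl d)} [IsProbabilityMeasure μ] [IsProbabilityMeasure ν]
  {N : ℕ} {η : ℕ → ℝ} {γ : ℕ → Measure (Eucl d × Eucl d)}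

variable (P Pt μ ν N η) in
theorem exists_isAuxProcess : ∃ γ, IsAuxProcess Pt P μ ν N η γ := by
  have hex : ∀ (p q : Measure (Eucl d)) [IsProbabilityMeasure p] [IsProbabilityMeasure q],
      ∃ m : ProbabilityMeasure (Eucl d × Eucl d), IsOptimalCoupling m.toMeasure p q := by
    intro p q _ _
    obtain ⟨m, hm⟩ := exists_isOptimalCoupling p q
    exact ⟨⟨m, hm.1.isProbabilityMeasure⟩, hm⟩
  obtain ⟨m₀, h₀⟩ := hex μ ν
  choose F hF using fun (n : ℕ) (m : ProbabilityMeasure (Eucl d × Eucl d)) =>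
    hex (lawAfter μ Pt (n + 1)) (P ∘ₘ m.toMeasure.map fun p => shiftPoint (η n) p.1 p.2)
  obtain ⟨g, hg₀, hg⟩ : ∃ g : ℕ → ProbabilityMeasure (Eucl d × Eucl d),
      g 0 = m₀ ∧ ∀ n, g (n + 1) = F n (g n) := ⟨fun n => Nat.rec m₀ F n, rfl, fun _ => rfl⟩
  refine ⟨fun n => (g n).toMeasure, ?_, fun n _ => ?_⟩
  · rw [hg₀]
    exact h₀
  · rw [hg]
    exact hF n (g n)

omit [IsMarkovKernel P] [IsMarkovKernel Pt] [IsProbabilityMeasure μ] [IsProbabilityMeasure ν] in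
lemma IsAuxProcess.map_fst (h : IsAuxProcess Pt P μ ν N η γ) {n : ℕ} (hn : n < N) :
    (γ n).map Prod.fst = lawAfter μ Pt n := by
  cases n with
  | zero => rw [lawAfter_zero]; exact h.init.1.1
  | succ n => exact (h.step n hn).1.1

omit [IsMarkovKernel P] [IsProbabilityMeasure ν] in
lemma IsAuxProcess.isProbabilityMeasure (h : IsAuxProcess Pt P μ ν N η γ) {n : ℕ} (hn : n < N) :
    IsProbabilityMeasure (γ n) :=
  IsCoupling.isProbabilityMeasure ⟨h.map_fst hn, rfl⟩

/-- The root mean square distance `(∫ ‖x - y‖² dγ)^(1/2)`. -/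
noncomputable def rmsDist (γ : Measure (Eucl d × Eucl d)) : ℝ≥0∞ :=
  eLpNorm (fun p : Eucl d × Eucl d => p.1 - p.2) 2 γ

lemma eLpNorm_two_sq {α E : Type*} [MeasurableSpace α] [NormedAddCommGroup E] (f : α → E)
    (ρ : Measure α) : eLpNorm f 2 ρ ^ 2 = ∫⁻ x, ‖f x‖ₑ ^ 2 ∂ρ := by
  have := eLpNorm_nnreal_pow_eq_lintegral (f := f) (μ := ρ) (p := 2) (by norm_num)
  simpa using this

lemma rmsDist_sq (γ : Measure (Eucl d × Eucl d)) : rmsDist γ ^ 2 = transportCost γ :=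
  eLpNorm_two_sq _ _

lemma lintegral_enorm_mul_le {α E F : Type*} [MeasurableSpace α] [NormedAddCommGroup E]
    [NormedAddCommGroup F] {f : α → E} {g : α → F} {ρ : Measure α}
    (hf : AEStronglyMeasurable f ρ) (hg : AEStronglyMeasurable g ρ) :
    ∫⁻ x, ‖f x‖ₑ * ‖g x‖ₑ ∂ρ ≤ eLpNorm f 2 ρ * eLpNorm g 2 ρ := by
  have h := ENNReal.lintegral_mul_le_Lp_mul_Lq ρ Real.HolderConjugate.two_two hf.enorm hg.enorm
  simp only [eLpNorm_eq_lintegral_rpow_enorm_toReal two_ne_zero ENNReal.ofNat_ne_top,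
    ENNReal.toReal_ofNat]
  exact h

omit [IsMarkovKernel Pt] [IsProbabilityMeasure μ] in
lemma eLpNorm_le_supL2Chain {f : Eucl d → ℝ} {n : ℕ} (hn : n < N) :
    eLpNorm f 2 (lawAfter μ Pt n) ≤ supL2Chain μ Pt N f :=
  le_iSup₂_of_le n hn le_rfl

lemma eLpNorm_le_supL2Aux {a₁ : Eucl d → Eucl d → ℝ} {n : ℕ} (hn : n < N) :
    eLpNorm (fun p => a₁ p.1 (shiftPoint (η n) p.1 p.2)) 2 (γ n) ≤ supL2Aux N η γ a₁ :=
  le_iSup₂_of_le n hn le_rfl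

omit [IsProbabilityMeasure ν] in
/-- One step of the distance recursion along the auxiliary process. -/
lemma rmsDist_succ_sq_le (h : IsAuxProcess Pt P μ ν N η γ) {n : ℕ} (hn : n + 1 < N)
    (hη : η n ≤ 1) {L : ℝ} {a₀ : Eucl d → ℝ} {a₁ : Eucl d → Eucl d → ℝ}
    (ha₀ : Measurable a₀) (ha₁ : Measurable (Function.uncurry a₁)) (ha₁0 : ∀ x y, 0 ≤ a₁ x y)
    (hW : ∀ x y, W2 (Pt x) (P y) ^ 2 ≤
      ENNReal.ofReal (L ^ 2 * ‖x - y‖ ^ 2 + 2 * a₁ x y * ‖x - y‖ + a₀ x ^ 2)) :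
    rmsDist (γ (n + 1)) ^ 2 ≤
      ENNReal.ofReal (L ^ 2) * (ENNReal.ofReal (1 - η n) * rmsDist (γ n)) ^ 2 +
        2 * supL2Aux N η γ a₁ * (ENNReal.ofReal (1 - η n) * rmsDist (γ n)) +
        supL2Chain μ Pt N a₀ ^ 2 := by
  have hp := h.isProbabilityMeasure (n := n) (by omega)
  have hs := measurable_shiftPoint (d := d) (η n)
  have hA : Measurable fun p : Eucl d × Eucl d => a₁ p.1 (shiftPoint (η n) p.1 p.2) :=
    ha₁.comp (measurable_fst.prodMk hs)
  set f : Eucl d × Eucl d → ℝ := fun p =>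
    L ^ 2 * ‖p.1 - shiftPoint (η n) p.1 p.2‖ ^ 2 +
      2 * a₁ p.1 (shiftPoint (η n) p.1 p.2) * ‖p.1 - shiftPoint (η n) p.1 p.2‖ + a₀ p.1 ^ 2 with hf
  have hfm : Measurable f := by
    have : Measurable fun p : Eucl d × Eucl d => ‖p.1 - shiftPoint (η n) p.1 p.2‖ :=
      (measurable_fst.sub hs).norm
    have h0 : Measurable fun p : Eucl d × Eucl d => a₀ p.1 := ha₀.comp measurable_fst
    exact ((measurable_const.mul (by fun_prop)).add ((hA.const_mul 2).mul (by fun_prop))).add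
      (h0.pow_const 2)
  -- The mixing parameter is the pair `(X n, Y' n)`: `Pt` acts on `X n` and `P` on the shifted
  -- point. The mixtures are the next marginals, and optimality of `γ (n + 1)` turns their
  -- Wasserstein distance into `rmsDist`.
  have hmix := W2_sq_comp_le (γ n) (Pt.comap Prod.fst measurable_fst) (P.comap _ hs) hfm
    fun p => hW p.1 (shiftPoint (η n) p.1 p.2)
  rw [comap_comp_eq_comp_map, comap_comp_eq_comp_map, h.map_fst (by omega), ← lawAfter_succ,
    ← (h.step n hn).2, ← rmsDist_sq] at hmix
  refine hmix.trans ?_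
  set t := ENNReal.ofReal (1 - η n) with ht
  have hpt : ∀ p, ENNReal.ofReal (f p) = ENNReal.ofReal (L ^ 2) * t ^ 2 * ‖p.1 - p.2‖ₑ ^ 2 +
      2 * t * (‖a₁ p.1 (shiftPoint (η n) p.1 p.2)‖ₑ * ‖p.1 - p.2‖ₑ) + ‖a₀ p.1‖ₑ ^ 2 := by
    intro p
    have h1 := ha₁0 p.1 (shiftPoint (η n) p.1 p.2)
    have h2 : 0 ≤ 1 - η n := by linarith
    simp only [hf]
    rw [norm_sub_shiftPoint hη, ENNReal.ofReal_add (by positivity) (by positivity),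
      ENNReal.ofReal_add (by positivity) (by positivity)]
    congr 1
    · congr 1
      · rw [ENNReal.ofReal_mul (by positivity), mul_pow, ENNReal.ofReal_mul (by positivity),
          ENNReal.ofReal_pow h2, ENNReal.ofReal_pow (norm_nonneg _), ofReal_norm, mul_assoc]
      · rw [ENNReal.ofReal_mul (by positivity), ENNReal.ofReal_mul (by positivity),
          ENNReal.ofReal_mul h2, ofReal_norm, ← ofReal_norm (a₁ _ _), Real.norm_of_nonneg h1]
        rw [ENNReal.ofReal_ofNat]
        ring
    · rw [← sq_abs, ENNReal.ofReal_pow (abs_nonneg _), ← Real.norm_eq_abs, ofReal_norm]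
  simp only [hpt]
  have hsub : Measurable fun p : Eucl d × Eucl d => p.1 - p.2 := by fun_prop
  rw [lintegral_add_left (by fun_prop), lintegral_add_left (by fun_prop),
    lintegral_const_mul _ (by fun_prop), lintegral_const_mul _ (by fun_prop)]
  have e1 : ∫⁻ p, ‖p.1 - p.2‖ₑ ^ 2 ∂(γ n) = rmsDist (γ n) ^ 2 := (eLpNorm_two_sq _ _).symm
  have e2 : ∫⁻ p, ‖a₁ p.1 (shiftPoint (η n) p.1 p.2)‖ₑ * ‖p.1 - p.2‖ₑ ∂(γ n) ≤
      supL2Aux N η γ a₁ * rmsDist (γ n) := by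
    refine (lintegral_enorm_mul_le hA.aestronglyMeasurable hsub.aestronglyMeasurable).trans ?_
    refine mul_le_mul_left ?_ _
    exact eLpNorm_le_supL2Aux (by omega)
  have e3 : ∫⁻ p, ‖a₀ p.1‖ₑ ^ 2 ∂(γ n) ≤ supL2Chain μ Pt N a₀ ^ 2 := by
    have : ∫⁻ p, ‖a₀ p.1‖ₑ ^ 2 ∂(γ n) = eLpNorm a₀ 2 (lawAfter μ Pt n) ^ 2 := by
      rw [eLpNorm_two_sq, ← h.map_fst (by omega), lintegral_map (by fun_prop) measurable_fst]
    rw [this]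
    gcongr
    exact eLpNorm_le_supL2Chain (by omega)
  rw [e1]
  have hfin : ∀ l t D A B I J : ℝ≥0∞, I ≤ A * D → J ≤ B →
      l * t ^ 2 * D ^ 2 + 2 * t * I + J ≤ l * (t * D) ^ 2 + 2 * A * (t * D) + B := by
    intro l t D A B I J hI hJ
    calc l * t ^ 2 * D ^ 2 + 2 * t * I + J ≤ l * t ^ 2 * D ^ 2 + 2 * t * (A * D) + B := by gcongr
      _ = _ := by ring
  exact hfin _ _ _ _ _ _ _ e2 e3

/-- Entropy of the auxiliary process relative to the chain with kernel `P`. -/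
lemma IsAuxProcess.entropyLE (h : IsAuxProcess Pt P μ ν N η γ) (hη : ∀ n, 0 ≤ η n) {c : ℝ}
    (hc : 0 ≤ c)
    (hKL : ∀ x y, InformationTheory.klDiv (P x) (P y) ≤ ENNReal.ofReal (c * ‖x - y‖ ^ 2))
    (hint : ∀ n < N, Integrable (fun p => c * ‖p.1 - p.2‖ ^ 2) (γ n)) {n : ℕ} (hn : n < N) :
    EntropyLE (P ∘ₘ (γ n).map fun p => shiftPoint (η n) p.1 p.2) (lawAfter ν P (n + 1))
      (∑ k ∈ Finset.range (n + 1), η k ^ 2 * ∫ p, c * ‖p.1 - p.2‖ ^ 2 ∂(γ k)) := by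
  -- The chain rule applied under `γ n`: the transition of `Y'` starts from the shifted point, that
  -- of the reference chain from `Y' n`, and these differ by `η n * ‖X n - Y' n‖` in norm.
  have step : ∀ n < N, ∀ K, EntropyLE ((γ n).map Prod.snd) (lawAfter ν P n) K →
      EntropyLE (P ∘ₘ (γ n).map fun p => shiftPoint (η n) p.1 p.2) (lawAfter ν P (n + 1))
        (K + η n ^ 2 * ∫ p, c * ‖p.1 - p.2‖ ^ 2 ∂(γ n)) := by
    intro n hn K hK
    have hp := h.isProbabilityMeasure hn
    rw [← comap_comp_eq_comp_map _ (measurable_shiftPoint (η n)), lawAfter_succ,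
      ← integral_const_mul]
    refine hK.comp ((hint n hn).const_mul _) fun p => ?_
    refine entropyLE_of_klDiv_le (by positivity) ((hKL _ _).trans (le_of_eq ?_))
    rw [norm_shiftPoint_sub (hη n)]
    congr 1
    ring
  induction n with
  | zero =>
    simp only [zero_add, Finset.sum_range_one]
    rw [← zero_add (η 0 ^ 2 * _)]
    refine step 0 hn 0 ?_
    rw [h.init.1.2, lawAfter_zero]
    exact entropyLE_self ν
  | succ n ih =>
    rw [Finset.sum_range_succ]
    refine step (n + 1) hn _ ?_
    rw [(h.step n hn).1.2]
    exact ih (by omega)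

/-- The last one-step error and the entropy of the auxiliary process control the total variation
distance of the two chains. -/
lemma IsAuxProcess.TV_le (h : IsAuxProcess Pt P μ ν N η γ) (hN : 1 ≤ N) (hη : ∀ n, 0 ≤ η n)
    (hη1 : η (N - 1) = 1) {c lam : ℝ} (hc : 0 ≤ c) {CTV : Eucl d → ℝ}
    (hCTVm : Measurable CTV) (hCTV0 : ∀ x, 0 ≤ CTV x)
    (hKL : ∀ x y, InformationTheory.klDiv (P x) (P y) ≤ ENNReal.ofReal (c * ‖x - y‖ ^ 2))
    (hTV : ∀ x, TV (Pt x) (P x) ≤ ENNReal.ofReal (CTV x * lam))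
    (hint : ∀ n < N, Integrable (fun p => c * ‖p.1 - p.2‖ ^ 2) (γ n)) :
    TV (lawAfter μ Pt N) (lawAfter ν P N) ≤
      supL2Chain μ Pt N CTV * ENNReal.ofReal lam +
        ENNReal.ofReal (2 * √(∑ k ∈ Finset.range N,
          η k ^ 2 * ∫ p, c * ‖p.1 - p.2‖ ^ 2 ∂(γ k))) := by
  obtain ⟨M, rfl⟩ := Nat.exists_eq_add_of_le' hN
  rw [Nat.add_sub_cancel] at hη1
  have hent := h.entropyLE hη hc hKL hint (n := M) (by omega)
  simp only [hη1, shiftPoint_one] at hent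
  have e : (γ M).map (fun p => p.1) = lawAfter μ Pt M := h.map_fst (by omega)
  rw [e] at hent
  -- The intermediate law is the endpoint of the auxiliary process, because `η M = 1`. Only the last
  -- step changes the kernel from `Pt` to `P`.
  refine (TV_triangle _ (P ∘ₘ lawAfter μ Pt M) _).trans (add_le_add ?_ (TV_le_of_entropyLE hent))
  rw [lawAfter_succ]
  refine (TV_comp_le _ _ _).trans ?_
  calc ∫⁻ x, TV (Pt x) (P x) ∂(lawAfter μ Pt M)
      ≤ ∫⁻ x, ‖CTV x‖ₑ * ENNReal.ofReal lam ∂(lawAfter μ Pt M) := by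
        refine lintegral_mono fun x => (hTV x).trans (le_of_eq ?_)
        rw [ENNReal.ofReal_mul (hCTV0 x), ← ofReal_norm, Real.norm_of_nonneg (hCTV0 x)]
    _ = eLpNorm CTV 1 (lawAfter μ Pt M) * ENNReal.ofReal lam := by
        rw [lintegral_mul_const _ (by fun_prop), eLpNorm_one_eq_lintegral_enorm]
    _ ≤ eLpNorm CTV 2 (lawAfter μ Pt M) * ENNReal.ofReal lam := by
        gcongr
        exact eLpNorm_le_eLpNorm_of_exponent_le (by norm_num) hCTVm.aestronglyMeasurable
    _ ≤ _ := by
        gcongr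
        exact eLpNorm_le_supL2Chain (by omega)

lemma integrable_norm_sub_sq {γ : Measure (Eucl d × Eucl d)} [IsFiniteMeasure γ]
    (h : rmsDist γ ≠ ∞) : Integrable (fun p => ‖p.1 - p.2‖ ^ 2) γ := by
  have : MemLp (fun p : Eucl d × Eucl d => p.1 - p.2) 2 γ :=
    ⟨by fun_prop, lt_top_iff_ne_top.2 h⟩
  exact this.integrable_norm_pow two_ne_zero

lemma integral_norm_sub_sq (γ : Measure (Eucl d × Eucl d)) :
    ∫ p, ‖p.1 - p.2‖ ^ 2 ∂γ = (rmsDist γ).toReal ^ 2 := by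
  rw [integral_eq_lintegral_of_nonneg_ae (.of_forall fun p => by positivity) (by fun_prop),
    ← transportCost_eq_lintegral_ofReal, ← rmsDist_sq, ENNReal.toReal_pow]

lemma w2Coeff_pos {L : ℝ} (hL : 0 < L) (hN : 1 ≤ N) : 0 < w2Coeff L N := by
  rw [w2Coeff_eq_inv_geomSum]
  have := one_le_geomSum (inv_pos.2 hL).le hN
  positivity

/-- For `1 / 2 ≤ L < 1` the second entry `1 / (1 - L)` of the minimum is at least `2`. With `r = 1,
2` this gives positivity of `Nbar` and of its logarithm. -/
lemma le_Nbar {L r : ℝ} (hL : 1 / 2 ≤ L) (hr : r ≤ 2) (hN : r ≤ N) : r ≤ Nbar L N := by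
  unfold Nbar
  split_ifs with h
  · refine le_min hN (hr.trans ?_)
    rw [le_div_iff₀ (by linarith)]
    linarith
  · exact hN

omit [IsProbabilityMeasure ν] in
/-- Finiteness of the distances along the auxiliary process. -/
lemma IsAuxProcess.rmsDist_ne_top (h : IsAuxProcess Pt P μ ν N η γ) (hη : ∀ n, η n ≤ 1) {L : ℝ}
    {a₀ : Eucl d → ℝ} {a₁ : Eucl d → Eucl d → ℝ} (ha₀ : Measurable a₀)
    (ha₁ : Measurable (Function.uncurry a₁)) (ha₁0 : ∀ x y, 0 ≤ a₁ x y)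
    (hW : ∀ x y, W2 (Pt x) (P y) ^ 2 ≤
      ENNReal.ofReal (L ^ 2 * ‖x - y‖ ^ 2 + 2 * a₁ x y * ‖x - y‖ + a₀ x ^ 2))
    (h0 : W2 μ ν ≠ ∞) (hS0 : 2 ≤ N → supL2Chain μ Pt N a₀ ≠ ∞)
    (hS1 : supL2Aux N η γ a₁ ≠ ∞) {n : ℕ} (hn : n < N) : rmsDist (γ n) ≠ ∞ := by
  induction n with
  | zero =>
    have h1 : rmsDist (γ 0) ^ 2 ≠ ∞ := by
      rw [rmsDist_sq, h.init.2]
      exact ENNReal.pow_ne_top h0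
    exact fun h2 => h1 (by simp [h2])
  | succ n ih =>
    have h1 := rmsDist_succ_sq_le h hn (hη n) ha₀ ha₁ ha₁0 hW
    have ih := ih (by omega)
    have hS0 := hS0 (by omega)
    have h2 : rmsDist (γ (n + 1)) ^ 2 ≠ ∞ := ne_top_of_le_ne_top (by finiteness) h1
    exact fun h3 => h2 (by simp [h3])

omit [IsProbabilityMeasure ν] in
/-- Quantitative bound on the entropy of the auxiliary process for the coefficients
`shiftCoeff L N`. -/
lemma IsAuxProcess.sum_shiftCoeff_le {L : ℝ} (h : IsAuxProcess Pt P μ ν N (shiftCoeff L N) γ)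
    (hN : 1 ≤ N) (hL : 1 / 2 ≤ L) (hL2 : L ≤ 2)
    {a₀ : Eucl d → ℝ} {a₁ : Eucl d → Eucl d → ℝ} (ha₀ : Measurable a₀)
    (ha₁ : Measurable (Function.uncurry a₁)) (ha₁0 : ∀ x y, 0 ≤ a₁ x y)
    (hW : ∀ x y, W2 (Pt x) (P y) ^ 2 ≤
      ENNReal.ofReal (L ^ 2 * ‖x - y‖ ^ 2 + 2 * a₁ x y * ‖x - y‖ + a₀ x ^ 2))
    (h0 : W2 μ ν ≠ ∞) (hS0 : 2 ≤ N → supL2Chain μ Pt N a₀ ≠ ∞)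
    (hS1 : supL2Aux N (shiftCoeff L N) γ a₁ ≠ ∞) :
    ENNReal.ofReal (∑ n ∈ Finset.range N, shiftCoeff L N n ^ 2 * (rmsDist (γ n)).toReal ^ 2) ≤
      50 * (ENNReal.ofReal (w2Coeff L N) * W2 μ ν ^ 2 +
        ENNReal.ofReal (max ((L - 1) * N) (Real.log (Nbar L N))) * supL2Chain μ Pt N a₀ ^ 2 +
        ENNReal.ofReal (Nbar L N) * supL2Aux N (shiftCoeff L N) γ a₁ ^ 2) := by
  have hfin : ∀ n < N, rmsDist (γ n) ≠ ∞ := fun n hn =>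
    h.rmsDist_ne_top (shiftCoeff_le_one L N) ha₀ ha₁ ha₁0 hW h0 hS0 hS1 hn
  set S₀ := supL2Chain μ Pt N a₀
  set S₁ := supL2Aux N (shiftCoeff L N) γ a₁
  have key := sum_shiftCoeff_sq_mul_le (a := S₀.toReal) (b := S₁.toReal) hL hL2 hN
    ENNReal.toReal_nonneg (fun n => (rmsDist (γ n)).toReal) (fun n => ENNReal.toReal_nonneg)
    (by
      intro n hn
      have h1 := rmsDist_succ_sq_le h hn (shiftCoeff_le_one L N n) ha₀ ha₁ ha₁0 hW
      have hD := hfin n (by omega)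
      have hS0 := hS0 (by omega)
      have h2 := ENNReal.toReal_mono (by finiteness) h1
      rw [ENNReal.toReal_add (by finiteness) (by finiteness),
        ENNReal.toReal_add (by finiteness) (by finiteness)] at h2
      simp only [ENNReal.toReal_mul, ENNReal.toReal_pow, ENNReal.toReal_ofNat] at h2
      rwa [ENNReal.toReal_ofReal (sq_nonneg L),
        ENNReal.toReal_ofReal (sub_nonneg.2 (shiftCoeff_le_one L N n))] at h2)
  have hsq : ∀ s : ℝ≥0∞, ENNReal.ofReal (s.toReal ^ 2) ≤ s ^ 2 := fun s => by
    rw [ENNReal.ofReal_pow ENNReal.toReal_nonneg]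
    gcongr
    exact ENNReal.ofReal_toReal_le
  refine (ENNReal.ofReal_le_ofReal key).trans ?_
  rw [ENNReal.ofReal_mul (by norm_num), ENNReal.ofReal_ofNat]
  gcongr
  refine ENNReal.ofReal_add_le.trans (add_le_add (ENNReal.ofReal_add_le.trans (add_le_add ?_ ?_)) ?_)
  · rw [ENNReal.ofReal_mul' (sq_nonneg _)]
    gcongr
    rw [← h.init.2, ← rmsDist_sq]
    exact hsq _
  · rw [ENNReal.ofReal_mul' (sq_nonneg _)]
    gcongr
    exact hsq _
  · rw [ENNReal.ofReal_mul' (sq_nonneg _)]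
    gcongr
    exact hsq _

lemma ofReal_sqrt (x : ℝ) : ENNReal.ofReal √x = ENNReal.ofReal x ^ (1 / 2 : ℝ) := by
  rcases le_total 0 x with h | h
  · rw [Real.sqrt_eq_rpow, ENNReal.ofReal_rpow_of_nonneg h (by norm_num)]
  · rw [Real.sqrt_eq_zero_of_nonpos h, ENNReal.ofReal_of_nonpos h]
    simp

/-- Origin of the final constant: the Pinsker factor `2` and the factor `50` combine to `2 ^ 2 * 50
= 200 ≤ 15 ^ 2`. -/
lemma two_mul_ofReal_sqrt_le {x c : ℝ} (hc : 0 ≤ c) {y : ℝ≥0∞} (h : ENNReal.ofReal x ≤ 50 * y) :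
    ENNReal.ofReal (2 * √(c * x)) ≤ 15 * (ENNReal.ofReal c * y) ^ (1 / 2 : ℝ) := by
  have h15 : (15 : ℝ≥0∞) = (15 ^ 2 : ℝ≥0∞) ^ (1 / 2 : ℝ) := by
    rw [← ENNReal.rpow_natCast, ← ENNReal.rpow_mul]
    norm_num
  have h2 : 2 * √(c * x) = √(4 * (c * x)) := by
    rw [Real.sqrt_mul zero_le_four, show (4 : ℝ) = 2 ^ 2 by norm_num, Real.sqrt_sq zero_le_two]
  rw [h2, ofReal_sqrt, h15, ← ENNReal.mul_rpow_of_nonneg _ _ (by norm_num)]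
  gcongr
  rw [ENNReal.ofReal_mul (by norm_num), ENNReal.ofReal_mul hc, ENNReal.ofReal_ofNat]
  calc 4 * (ENNReal.ofReal c * ENNReal.ofReal x)
      ≤ 4 * (ENNReal.ofReal c * (50 * y)) := by gcongr
    _ = 200 * (ENNReal.ofReal c * y) := by ring
    _ ≤ 15 ^ 2 * (ENNReal.ofReal c * y) := by
        gcongr
        norm_num

end AuxProcess

end TVLocalError

/-! ### Assembly and the infinite cases. -/

theorem mainTheorem4 :
    ∃ C : ℝ, 0 < C ∧
    ∀ (N : ℕ), 1 ≤ N → ∀ (L : ℝ), 1 / 2 ≤ L → L ≤ 2 →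
    ∃ η : ℕ → ℝ, (∀ n, 0 ≤ η n ∧ η n ≤ 1) ∧ η (N - 1) = 1 ∧
    ∀ (d : ℕ) (P Pt : Kernel (Eucl d) (Eucl d)) [IsMarkovKernel P] [IsMarkovKernel Pt]
      (lam c : ℝ) (a₀ : Eucl d → ℝ) (a₁ : Eucl d → Eucl d → ℝ) (CTV : Eucl d → ℝ)
      (μ ν : Measure (Eucl d)) [IsProbabilityMeasure μ] [IsProbabilityMeasure ν],
      0 < lam → 0 ≤ c →
      Measurable a₀ → (∀ x, 0 ≤ a₀ x) →
      Measurable (Function.uncurry a₁) → (∀ x y, 0 ≤ a₁ x y) →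
      Measurable CTV → (∀ x, 0 ≤ CTV x) →
      MemLp id 2 μ → MemLp id 2 ν →
      -- one-step Wasserstein bound
      (∀ x y, W2 (Pt x) (P y) ^ 2 ≤
        ENNReal.ofReal (L ^ 2 * ‖x - y‖ ^ 2 + 2 * a₁ x y * ‖x - y‖ + a₀ x ^ 2)) →
      -- regularity of the kernel `P`
      (∀ x y, InformationTheory.klDiv (P x) (P y) ≤ ENNReal.ofReal (c * ‖x - y‖ ^ 2)) →
      -- one-step total variation local error
      (∀ x, TV (Pt x) (P x) ≤ ENNReal.ofReal (CTV x * lam)) →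
      (∃ γ, IsAuxProcess Pt P μ ν N η γ) ∧
      ∀ γ, IsAuxProcess Pt P μ ν N η γ →
        TV (lawAfter μ Pt N) (lawAfter ν P N) ≤
          ENNReal.ofReal C *
            (supL2Chain μ Pt N CTV * ENNReal.ofReal lam +
              (ENNReal.ofReal c *
                (ENNReal.ofReal (w2Coeff L N) * W2 μ ν ^ 2 +
                  ENNReal.ofReal (max ((L - 1) * N) (Real.log (Nbar L N))) *
                    supL2Chain μ Pt N a₀ ^ 2 +
                  ENNReal.ofReal (Nbar L N) * supL2Aux N η γ a₁ ^ 2)) ^ (1 / 2 : ℝ)) := by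
  refine ⟨15, by norm_num, fun N hN L hL hL2 => ⟨shiftCoeff L N,
    fun n => ⟨shiftCoeff_nonneg L N n, shiftCoeff_le_one L N n⟩, shiftCoeff_pred L hN, ?_⟩⟩
  intro d P Pt _ _ lam c a₀ a₁ CTV μ ν _ _ hlam hc ha₀ _ ha₁ ha₁0 hCTV hCTV0 _ _ hW hKL hTV
  refine ⟨exists_isAuxProcess P Pt μ ν N _, fun γ h => ?_⟩
  rw [ENNReal.ofReal_ofNat]
  set S₀ := supL2Chain μ Pt N a₀
  set S₁ := supL2Aux N (shiftCoeff L N) γ a₁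
  set Y := ENNReal.ofReal (w2Coeff L N) * W2 μ ν ^ 2 +
    ENNReal.ofReal (max ((L - 1) * N) (Real.log (Nbar L N))) * S₀ ^ 2 +
    ENNReal.ofReal (Nbar L N) * S₁ ^ 2
  -- If the quantity under the root is infinite the bound is trivial; otherwise an entropy bound `K`
  -- is to be found.
  suffices hmain : (ENNReal.ofReal c * Y ≠ ∞) →
      ∃ K, ENNReal.ofReal (2 * √K) ≤ 15 * (ENNReal.ofReal c * Y) ^ (1 / 2 : ℝ) ∧
        TV (lawAfter μ Pt N) (lawAfter ν P N) ≤
          supL2Chain μ Pt N CTV * ENNReal.ofReal lam + ENNReal.ofReal (2 * √K) by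
    by_cases htop : ENNReal.ofReal c * Y = ∞
    · rw [htop, ENNReal.top_rpow_of_pos (by norm_num), add_top, ENNReal.mul_top (by norm_num)]
      exact le_top
    · obtain ⟨K, hK, hle⟩ := hmain htop
      refine hle.trans ?_
      rw [mul_add]
      exact add_le_add (le_mul_of_one_le_left zero_le (by norm_num)) hK
  intro htop
  have hη := shiftCoeff_nonneg L N
  have hη1 := shiftCoeff_pred L hN
  -- For `c = 0` the convention `0 * ∞ = 0` allows `Y` and the distances to be infinite, but then
  -- the entropy bound vanishes and no moment is required.
  rcases hc.eq_or_lt with rfl | hc0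
  · refine ⟨_, ?_, h.TV_le hN hη hη1 le_rfl hCTV hCTV0 hKL hTV (fun n _ => by simp)⟩
    simp
  · have hY : Y ≠ ∞ := fun hY => htop (by rw [hY]; exact ENNReal.mul_top (by simpa using hc0))
    have hY' := ENNReal.add_ne_top.1 hY
    have hY'' := ENNReal.add_ne_top.1 hY'.1
    have hfin : ∀ (r : ℝ) (s : ℝ≥0∞), 0 < r → ENNReal.ofReal r * s ^ 2 ≠ ∞ → s ≠ ∞ := by
      intro r s hr hs hst
      refine hs ?_
      rw [hst]
      simp [ENNReal.mul_top, hr]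
    have h0 : W2 μ ν ≠ ∞ := hfin _ _ (w2Coeff_pos (by linarith) hN) hY''.1
    have hS1 : S₁ ≠ ∞ := hfin _ _
      (one_pos.trans_le (le_Nbar hL (by norm_num) (by exact_mod_cast hN))) hY'.2
    -- For `N = 1` and `L ≤ 1` the coefficient of `S₀ ^ 2` is zero, so finiteness of `Y` says
    -- nothing about `S₀`; but then the distance recursion has no step. For `N ≥ 2` one has `Nbar L
    -- N ≥ 2`, and the coefficient is positive.
    have hS0 : 2 ≤ N → S₀ ≠ ∞ := fun hN2 => hfin _ _ (lt_max_of_lt_right (Real.log_pos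
      (one_lt_two.trans_le (le_Nbar hL le_rfl (by exact_mod_cast hN2))))) hY''.2
    have hsum := h.sum_shiftCoeff_le hN hL hL2 ha₀ ha₁ ha₁0 hW h0 hS0 hS1
    refine ⟨_, two_mul_ofReal_sqrt_le hc hsum, ?_⟩
    have hd : ∀ n < N, rmsDist (γ n) ≠ ∞ := fun n hn =>
      h.rmsDist_ne_top (shiftCoeff_le_one L N) ha₀ ha₁ ha₁0 hW h0 hS0 hS1 hn
    refine (h.TV_le hN hη hη1 hc hCTV hCTV0 hKL hTV fun n hn => ?_).trans (le_of_eq ?_)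
    · have := h.isProbabilityMeasure hn
      exact (integrable_norm_sub_sq (hd n hn)).const_mul c
    · congr 4
      rw [Finset.mul_sum]
      refine Finset.sum_congr rfl fun n _ => ?_
      rw [integral_const_mul, integral_norm_sub_sq]
      ring
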